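/- Let $u=(u_1,u_2)\in\mathbb R^2$ be planar elliptic coordinates with foci at distance $\kappa>0$ from the origin and $p=(p_1,p_2)\in\mathbb R^2$ the conjugate momenta, with the canonical Poisson bracket $\{F,G\}=\sum_i\left(\frac{\partial F}{\partial u_i}\frac{\partial G}{\partial p_i}-\frac{\partial F}{\partial p_i}\frac{\partial G}{\partial u_i}\right)$ on complex-valued functions of $(u,p)$. For potentials $V_1,V_2$ (differentiable complex-valued functions of a real variable) and parameters $k_1,k_2\in\mathbb C\setminus\{0\}$ put, where $u_1^2\ne u_2^2$, $$A_i=(u_i^2-\kappa^2)\left(\left(\frac{p_i}{k_i}\right)^2+V_i(u_i)\right),\qquad I_1=\frac{A_1}{u_1^2-u_2^2}+\frac{A_2}{u_2^2-u_1^2},\qquad I_2=-\frac{u_2^2A_1}{u_1^2-u_2^2}-\frac{u_1^2A_2}{u_2^2-u_1^2},\qquad H=2I_1 .$$ **(a)** For all $V_1,V_2$ and $k_1,k_2$ one has $\{H,I_2\}=0$. **(b)** Let $k_1,k_2$ be positive integers and $\alpha\in\mathbb C$, and let either $V_i(u_i)=\frac{\alpha u_i}{u_i^2-\kappa^2}$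 for $i=1,2$ (Kepler) or $V_i(u_i)=-\alpha^2u_i^2$ for $i=1,2$ (oscillator). Let $f(x)=a_4x^4+a_3x^3+a_2x^2+a_1x+a_0$ and $P_i=(x_i,y_i)$ be given by * Kepler: $a_4=I_1,\ a_3=-\alpha,\ a_2=I_2-\kappa^2I_1,\ a_1=\alpha\kappa^2,\ a_0=-\kappa^2I_2$, and $x_i=u_i,\ y_i=(u_i^2-\kappa^2)\,p_i/k_i$; * oscillator: $a_4=\alpha^2,\ a_3=I_1-2\alpha^2\kappa^2,\ a_2=\alpha^2\kappa^4-\kappa^2I_1+I_2,\ a_1=-\kappa^2I_2,\ a_0=0$, and $x_i=u_i^2,\ y_i=u_i(u_i^2-\kappa^2)\,p_i/k_i$. Let $U$ be an open set of phase points with $u_1^2\ne u_2^2$ and $u_i^2\neq\kappa^2$, and $\sqrt{a_4}$ a differentiable function on $U$ whose square is $a_4$. The sum of two points $P=(x_P,y_P)$, $Q=(x_Q,y_Q)$ of the curve $y^2=f(x)$ is the point $(x_3,-\mathcal P(x_3))$ with $$x_3=-x_P-x_Q-\frac{2b_0b_2+b_1^2-a_2}{2b_1b_2-a_3},\qquad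 \mathcal P(x)=b_2x^2+b_1x+b_0=\sqrt{a_4}\,(x-x_P)(x-x_Q)+\ell\,(x-x_P)+y_P,$$ where $\ell=\frac{y_P-y_Q}{x_P-x_Q}$ if $x_P\ne x_Q$, and $\ell=\frac{f'(x_P)}{2y_P}$ if $P=Q$. Let $[1]P=P$, $[m+1]P=[m]P+P$, with $[2]P=P+P$ the doubling and the chord formula used for $m\ge2$; write $[m](x,y)=([m]x,[m]y)$, and $$C_{k_1k_2}=\left(\frac{[k_1]y_1-[k_2]y_2}{[k_1]x_1-[k_2]x_2}\right)^2-a_4\bigl([k_1]x_1+[k_2]x_2\bigr)^2-a_3\bigl([k_1]x_1+[k_2]x_2\bigr).$$ Then, on $U$: the points $P_1,P_2$ lie on the curve $y^2=f(x)$; at every phase point at which no denominator in the construction of $C_{k_1k_2}$ vanishes, $C_{k_1k_2}$ is differentiable and $$\{H,C_{k_1k_2}\}=0;$$ and there is a dense open subset of $U$ at all points of which no such denominator vanishes and the differentials $dI_1,dI_2,dC_{k_1k_2}$ are linearly independent (over $\mathbb C$), i.e. $C_{k_1k_2}$ is functionally independent of $I_1,I_2$. -/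

import Mathlib

noncomputable section

namespace EulerPlane

/-! ### Phase space and Poisson bracket -/

/-- A phase point `z = (u, p)`: elliptic coordinates `z.1 i` and conjugate momenta `z.2 i`;
the indices `0, 1` stand for the usual `1, 2`. -/
abbrev Phase : Type := (Fin 2 → ℝ) × (Fin 2 → ℝ)

/-- The partial derivative `∂F/∂uᵢ`. -/
def dU (i : Fin 2) (F : Phase → ℂ) (z : Phase) : ℂ := fderiv ℝ F z (Pi.single i 1, 0)

/-- The partial derivative `∂F/∂pᵢ`. -/
def dP (i : Fin 2) (F : Phase → ℂ) (z : Phase) : ℂ := fderiv ℝ F z (0, Pi.single i 1)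

/-- The canonical Poisson bracket, `{uᵢ, pⱼ} = δᵢⱼ`, of complex-valued functions. -/
def bracket (F G : Phase → ℂ) (z : Phase) : ℂ :=
  ∑ i, (dU i F z * dP i G z - dP i F z * dU i G z)

/-- The part of phase space where the elliptic coordinates are nonsingular. -/
def domain (κ : ℝ) : Set Phase :=
  {z | z.1 0 ^ 2 ≠ z.1 1 ^ 2 ∧ z.1 0 ^ 2 ≠ κ ^ 2 ∧ z.1 1 ^ 2 ≠ κ ^ 2}

/-! ### The integrals of motion `I₁`, `I₂` and the Hamiltonian -/

/-- `(uᵢ² - κ²) ((pᵢ / kᵢ)² + Vᵢ(uᵢ))`. -/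
def summand (κ : ℝ) (k : Fin 2 → ℂ) (V : Fin 2 → ℝ → ℂ) (i : Fin 2) (z : Phase) : ℂ :=
  ((z.1 i : ℂ) ^ 2 - (κ : ℂ) ^ 2) * (((z.2 i : ℂ) / k i) ^ 2 + V i (z.1 i))

def I₁ (κ : ℝ) (k : Fin 2 → ℂ) (V : Fin 2 → ℝ → ℂ) (z : Phase) : ℂ :=
  summand κ k V 0 z / ((z.1 0 : ℂ) ^ 2 - (z.1 1 : ℂ) ^ 2)
    + summand κ k V 1 z / ((z.1 1 : ℂ) ^ 2 - (z.1 0 : ℂ) ^ 2)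

def I₂ (κ : ℝ) (k : Fin 2 → ℂ) (V : Fin 2 → ℝ → ℂ) (z : Phase) : ℂ :=
  -((z.1 1 : ℂ) ^ 2 * summand κ k V 0 z / ((z.1 0 : ℂ) ^ 2 - (z.1 1 : ℂ) ^ 2))
    - (z.1 0 : ℂ) ^ 2 * summand κ k V 1 z / ((z.1 1 : ℂ) ^ 2 - (z.1 0 : ℂ) ^ 2)

/-- The Hamiltonian `H = 2 I₁`. -/
def hamiltonian (κ : ℝ) (k : Fin 2 → ℂ) (V : Fin 2 → ℝ → ℂ) (z : Phase) : ℂ :=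
  2 * I₁ κ k V z

/-! ### Arithmetic on a quartic curve `y² = f(x)` -/

/-- The coefficients of `f(x) = a₄x⁴ + a₃x³ + a₂x² + a₁x + a₀`. -/
structure Quartic where
  a₄ : ℂ
  a₃ : ℂ
  a₂ : ℂ
  a₁ : ℂ
  a₀ : ℂ

namespace Quartic

variable (q : Quartic)

def f (x : ℂ) : ℂ := q.a₄ * x ^ 4 + q.a₃ * x ^ 3 + q.a₂ * x ^ 2 + q.a₁ * x + q.a₀

/-- The derivative of `f`. -/
def f' (x : ℂ) : ℂ := 4 * q.a₄ * x ^ 3 + 3 * q.a₃ * x ^ 2 + 2 * q.a₂ * x + q.a₁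

/-- Points of the affine plane `(x, y)` that lie on the curve. -/
def OnCurve (P : ℂ × ℂ) : Prop := P.2 ^ 2 = q.f P.1

/-- Slope at `P` and `Q` of the chord through `P` and `Q`. -/
def chordSlope (P Q : ℂ × ℂ) : ℂ := (P.2 - Q.2) / (P.1 - Q.1)

/-- Slope of the tangent line of the curve at `P`. -/
def tangentSlope (P : ℂ × ℂ) : ℂ := q.f' P.1 / (2 * P.2)

/-! With `s` a square root of `a₄`, the points `P`, `Q` and a slope `ℓ` determine the parabola
`𝒫(x) = b₂x² + b₁x + b₀ = s(x - x_P)(x - x_Q) + ℓ(x - x_P) + y_P`. -/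

def b₂ (s : ℂ) : ℂ := s

def b₁ (s ℓ : ℂ) (P Q : ℂ × ℂ) : ℂ := ℓ - s * (P.1 + Q.1)

def b₀ (s ℓ : ℂ) (P Q : ℂ × ℂ) : ℂ := s * P.1 * Q.1 - ℓ * P.1 + P.2

/-- The denominator `2b₁b₂ - a₃` of the addition formula. -/
def sumDenom (s ℓ : ℂ) (P Q : ℂ × ℂ) : ℂ := 2 * b₁ s ℓ P Q * b₂ s - q.a₃

/-- The point `(x₃, -𝒫(x₃))`, where `x₃` is the abscissa of the third affine intersection of the
parabola with the curve. -/
def parabolaSum (s ℓ : ℂ) (P Q : ℂ × ℂ) : ℂ × ℂ :=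
  let x₃ : ℂ := -P.1 - Q.1
    - (2 * b₀ s ℓ P Q * b₂ s + b₁ s ℓ P Q ^ 2 - q.a₂) / q.sumDenom s ℓ P Q
  (x₃, -(b₂ s * x₃ ^ 2 + b₁ s ℓ P Q * x₃ + b₀ s ℓ P Q))

/-- Addition of points with different abscissas. -/
def add (s : ℂ) (P Q : ℂ × ℂ) : ℂ × ℂ := q.parabolaSum s (chordSlope P Q) P Q

def AddDefined (s : ℂ) (P Q : ℂ × ℂ) : Prop :=
  P.1 ≠ Q.1 ∧ q.sumDenom s (chordSlope P Q) P Q ≠ 0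

/-- Doubling of a point with nonzero ordinate. -/
def double (s : ℂ) (P : ℂ × ℂ) : ℂ × ℂ := q.parabolaSum s (q.tangentSlope P) P P

def DoubleDefined (s : ℂ) (P : ℂ × ℂ) : Prop :=
  P.2 ≠ 0 ∧ q.sumDenom s (q.tangentSlope P) P P ≠ 0

/-- `[m]P = ([m]x, [m]y)` for `m ≥ 1`, by `[1]P = P`, `[2]P = P + P` (doubling) and
`[m + 1]P = [m]P + P`.  The value at `m = 0` plays no role. -/
def mult (s : ℂ) : ℕ → ℂ × ℂ → ℂ × ℂ
  | 0, _ => (0, 0)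
  | 1, P => P
  | 2, P => q.double s P
  | (n + 3), P => q.add s (mult s (n + 2) P) P

/-- No denominator vanishes in the computation of `[m]P`. -/
def MultDefined (s : ℂ) : ℕ → ℂ × ℂ → Prop
  | 0, _ => False
  | 1, _ => True
  | 2, P => q.DoubleDefined s P
  | (n + 3), P => MultDefined s (n + 2) P ∧ q.AddDefined s (q.mult s (n + 2) P) P

/-- Euler's integral of `m dx₁/y₁ + n dx₂/y₂ = 0`. -/
def eulerIntegral (s : ℂ) (m n : ℕ) (P₁ P₂ : ℂ × ℂ) : ℂ :=
  chordSlope (q.mult s m P₁) (q.mult s n P₂) ^ 2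
    - q.a₄ * ((q.mult s m P₁).1 + (q.mult s n P₂).1) ^ 2
    - q.a₃ * ((q.mult s m P₁).1 + (q.mult s n P₂).1)

/-- No denominator vanishes in the computation of Euler's integral. -/
def EulerDefined (s : ℂ) (m n : ℕ) (P₁ P₂ : ℂ × ℂ) : Prop :=
  q.MultDefined s m P₁ ∧ q.MultDefined s n P₂ ∧ (q.mult s m P₁).1 ≠ (q.mult s n P₂).1

end Quartic

/-! ### The two families of potentials, their curves and points -/

inductive Model where
  | kepler
  | oscillator

namespace Model

/-- `V(u) = αu / (u² - κ²)`, respectively `V(u) = -α²u²`. -/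
def potential (κ : ℝ) (α : ℂ) : Model → ℝ → ℂ
  | kepler, u => α * (u : ℂ) / ((u : ℂ) ^ 2 - (κ : ℂ) ^ 2)
  | oscillator, u => -α ^ 2 * (u : ℂ) ^ 2

/-- The quartic, as a function of the values `J₁`, `J₂` of the integrals `I₁`, `I₂`. -/
def quartic (κ : ℝ) (α J₁ J₂ : ℂ) : Model → Quartic
  | kepler =>
    { a₄ := J₁
      a₃ := -α
      a₂ := J₂ - (κ : ℂ) ^ 2 * J₁
      a₁ := α * (κ : ℂ) ^ 2
      a₀ := -(κ : ℂ) ^ 2 * J₂ }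
  | oscillator =>
    { a₄ := α ^ 2
      a₃ := J₁ - 2 * α ^ 2 * (κ : ℂ) ^ 2
      a₂ := α ^ 2 * (κ : ℂ) ^ 4 - (κ : ℂ) ^ 2 * J₁ + J₂
      a₁ := -(κ : ℂ) ^ 2 * J₂
      a₀ := 0 }

/-- The point `Pᵢ = (xᵢ, yᵢ)`. -/
def point (κ : ℝ) (k : Fin 2 → ℂ) (i : Fin 2) (z : Phase) : Model → ℂ × ℂ
  | kepler => ((z.1 i : ℂ), ((z.1 i : ℂ) ^ 2 - (κ : ℂ) ^ 2) * ((z.2 i : ℂ) / k i))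
  | oscillator =>
    ((z.1 i : ℂ) ^ 2, (z.1 i : ℂ) * ((z.1 i : ℂ) ^ 2 - (κ : ℂ) ^ 2) * ((z.2 i : ℂ) / k i))

variable (M : Model) (κ : ℝ) (α : ℂ) (k : Fin 2 → ℕ)

/-- The parameters `k₁, k₂` as complex numbers. -/
def kC (k : Fin 2 → ℕ) (i : Fin 2) : ℂ := (k i : ℂ)

/-- `I₁` for the potentials `V₁ = V₂` of the model. -/
def J₁ (z : Phase) : ℂ := I₁ κ (kC k) (fun _ => M.potential κ α) z

/-- `I₂` for the potentials `V₁ = V₂` of the model. -/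
def J₂ (z : Phase) : ℂ := I₂ κ (kC k) (fun _ => M.potential κ α) z

/-- The Hamiltonian for the potentials `V₁ = V₂` of the model. -/
def H (z : Phase) : ℂ := hamiltonian κ (kC k) (fun _ => M.potential κ α) z

/-- The quartic attached to the phase point `z`. -/
def curve (z : Phase) : Quartic := M.quartic κ α (M.J₁ κ α k z) (M.J₂ κ α k z)

/-- The phase function `C_{k₁k₂}`, for a choice `s` of the square root of `a₄`. -/
def C (s : Phase → ℂ) (z : Phase) : ℂ :=
  (M.curve κ α k z).eulerIntegral (s z) (k 0) (k 1)
    (M.point κ (kC k) 0 z) (M.point κ (kC k) 1 z)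

/-- `z` is a point at which the formulas for `C_{k₁k₂}` involve no vanishing denominator. -/
def CDefined (s : Phase → ℂ) (z : Phase) : Prop :=
  (M.curve κ α k z).EulerDefined (s z) (k 0) (k 1)
    (M.point κ (kC k) 0 z) (M.point κ (kC k) 1 z)

end Model

end EulerPlane

end

/-! The proof differentiates along complex tangent vectors, chosen point by point. The definitions
of I₁, I₂ amount to the separation relations A_i = I₁ u_i² + I₂ (`I₁_mul_sq_add_I₂`). Hence for each
i there is a vector field in the directions u_i, p_i alone that annihilates I₁ and I₂ (`separated`),
and the Hamiltonian field of H is 2/(u₁² - u₂²) times the difference of these two fields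
(`bracket_hamiltonian`). Part (a) follows at once.

For the two models, the separation relation multiplied by u_i² - κ², respectively u_i²(u_i² - κ²),
is the equation y_i² = f(x_i). Field i fixes the curve and the other point, and moves P_i with speed
c/k_i measured by dx/y, where c depends only on the model (`moves_point`, `rests_point`). By Abel's
theorem such speeds add under addition of points (`Moves.parabolaSum`), so [k_i]P_i moves with speed
c for either i. Euler's integral is a function of the sum of its two points, so its derivative is
the sum of their speeds times a common factor (`hasD_euler`). Thus C has equal derivatives along
both fields, and {H, C} = 0.

For independence it suffices that C has nonzero derivative along a field that annihilates I₁ and I₂,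
since dI₁ and dI₂ are already separated by the momenta. If a denominator of the construction, or
this derivative, vanished on an open set of generic points, differentiating the resulting identity
would lead to a contradiction: either a polynomial relation in x with constant coefficients, which
must be trivial (`coeff_eq_zero_of_sum_eq_zero`) and forces a multiple root of f, or two points with
the same coordinate but different nonzero speeds. Generic points are dense because the conditions on
them are polynomial in one momentum. -/

noncomputable section

namespace EulerPlane

/-! ### Derivations along complex combinations of directions -/

section Derivation

variable {E : Type*} [NormedAddCommGroup E] [NormedSpace ℝ E]

/-- `F` is differentiable at `z`, and the functional `T` takes the value `d` at its differential. -/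
def HasD (T : (E →L[ℝ] ℂ) →ₗ[ℂ] ℂ) (z : E) (F : E → ℂ) (d : ℂ) : Prop :=
  ∃ F' : E →L[ℝ] ℂ, HasFDerivAt F F' z ∧ T F' = d

variable {T : (E →L[ℝ] ℂ) →ₗ[ℂ] ℂ} {z : E} {F G : E → ℂ} {c d : ℂ}

namespace HasD

theorem differentiableAt (h : HasD T z F c) : DifferentiableAt ℝ F z :=
  let ⟨_, h, _⟩ := h
  h.differentiableAt

theorem continuousAt (h : HasD T z F c) : ContinuousAt F z := h.differentiableAt.continuousAt

theorem eq_fderiv (h : HasD T z F c) : T (fderiv ℝ F z) = c := by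
  obtain ⟨F', h, rfl⟩ := h
  rw [h.fderiv]

theorem of_differentiableAt (h : DifferentiableAt ℝ F z) : HasD T z F (T (fderiv ℝ F z)) :=
  ⟨_, h.hasFDerivAt, rfl⟩

/-- For the zero functional the calculus of `HasD` only tracks differentiability; this serves where
the square root has no derivative formula. -/
theorem zero (h : DifferentiableAt ℝ F z) : HasD 0 z F 0 := of_differentiableAt h

theorem unique (h : HasD T z F c) (h' : HasD T z F d) : c = d :=
  h.eq_fderiv.symm.trans h'.eq_fderiv

theorem congr_val (h : HasD T z F c) (e : c = d) : HasD T z F d := e ▸ h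

theorem congr_fun (h : HasD T z F c) (e : G =ᶠ[nhds z] F) : HasD T z G c :=
  let ⟨F', h, e'⟩ := h
  ⟨F', h.congr_of_eventuallyEq e, e'⟩

theorem const (a : ℂ) : HasD T z (fun _ => a) 0 := ⟨0, hasFDerivAt_const a z, map_zero T⟩

theorem add (hF : HasD T z F c) (hG : HasD T z G d) : HasD T z (fun w => F w + G w) (c + d) := by
  obtain ⟨F', hF, rfl⟩ := hF
  obtain ⟨G', hG, rfl⟩ := hG
  exact ⟨F' + G', hF.add hG, map_add T F' G'⟩

theorem neg (hF : HasD T z F c) : HasD T z (fun w => -F w) (-c) := by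
  obtain ⟨F', hF, rfl⟩ := hF
  exact ⟨-F', hF.neg, map_neg T F'⟩

theorem sub (hF : HasD T z F c) (hG : HasD T z G d) : HasD T z (fun w => F w - G w) (c - d) := by
  obtain ⟨F', hF, rfl⟩ := hF
  obtain ⟨G', hG, rfl⟩ := hG
  exact ⟨F' - G', hF.sub hG, map_sub T F' G'⟩

theorem mul (hF : HasD T z F c) (hG : HasD T z G d) :
    HasD T z (fun w => F w * G w) (c * G z + F z * d) := by
  obtain ⟨F', hF, rfl⟩ := hF
  obtain ⟨G', hG, rfl⟩ := hG
  refine ⟨F z • G' + G z • F', hF.mul hG, ?_⟩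
  simp only [map_add, map_smul, smul_eq_mul]
  ring

theorem const_mul (a : ℂ) (hF : HasD T z F c) : HasD T z (fun w => a * F w) (a * c) :=
  ((const a).mul hF).congr_val (by ring)

theorem pow (hF : HasD T z F c) (n : ℕ) : HasD T z (fun w => F w ^ n) (n * F z ^ (n - 1) * c) := by
  obtain ⟨F', hF, rfl⟩ := hF
  refine ⟨_, hF.pow n, ?_⟩
  simp

theorem inv (hF : HasD T z F c) (h0 : F z ≠ 0) : HasD T z (fun w => (F w)⁻¹) (-c / F z ^ 2) := by
  obtain ⟨F', hF, rfl⟩ := hF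
  have h := ((hasDerivAt_inv h0).hasFDerivAt.restrictScalars ℝ).comp z hF
  refine ⟨-(F z ^ 2)⁻¹ • F', h.congr_fderiv ?_, ?_⟩
  · ext v
    simp [mul_comm]
  · rw [map_smul, smul_eq_mul]
    field_simp

theorem div (hF : HasD T z F c) (hG : HasD T z G d) (h0 : G z ≠ 0) :
    HasD T z (fun w => F w / G w) ((c - F z / G z * d) / G z) := by
  have h := hF.mul (hG.inv h0)
  simp only [← div_eq_mul_inv] at h
  refine h.congr_val ?_
  field_simp
  ring

/-- A function of square `F` has derivative zero when `F` has. -/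
theorem of_sq (hF : HasD T z F 0) (hG : DifferentiableAt ℝ G z) (h0 : G z ≠ 0)
    (h : (fun w => G w ^ 2) =ᶠ[nhds z] F) : HasD T z G 0 := by
  have hG := of_differentiableAt (T := T) hG
  have h2 := (hG.pow 2).unique (hF.congr_fun h)
  refine hG.congr_val ?_
  simpa [h0] using h2

end HasD

/-- A polynomial relation whose coefficients have derivative zero, satisfied by a function with
nonvanishing derivative, is trivial. -/
theorem coeff_eq_zero_of_sum_eq_zero {B : Set E} (hB : IsOpen B) {D : E → (E →L[ℝ] ℂ) →ₗ[ℂ] ℂ}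
    {X r : E → ℂ} (hX : ∀ z ∈ B, HasD (D z) z X (r z)) (hr : ∀ z ∈ B, r z ≠ 0) (n : ℕ)
    (a : ℕ → E → ℂ) (ha : ∀ i, ∀ z ∈ B, HasD (D z) z (a i) 0)
    (h : ∀ z ∈ B, ∑ i ∈ Finset.range n, a i z * X z ^ i = 0) :
    ∀ i < n, ∀ z ∈ B, a i z = 0 := by
  induction n generalizing a with
  | zero => intro i hi; omega
  | succ n ih =>
    have hs : ∀ (m : ℕ), ∀ z ∈ B, HasD (D z) z (fun w => ∑ i ∈ Finset.range m, a i w * X w ^ i)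
        (∑ i ∈ Finset.range m, a i z * (i * X z ^ (i - 1) * r z)) := by
      intro m z hz
      induction m with
      | zero => simpa using HasD.const (T := D z) (z := z) 0
      | succ m ihm =>
        simp only [Finset.sum_range_succ]
        refine ihm.add (((ha m z hz).mul ((hX z hz).pow m)).congr_val (by ring))
    -- Differentiating the relation and dividing by the nonzero derivative of `X` gives a relation
    -- of lower degree, whose coefficients again have derivative zero.
    have h1 : ∀ i < n, ∀ z ∈ B, ((i + 1 : ℕ) : ℂ) * a (i + 1) z = 0 := by
      refine ih (fun i z => ((i + 1 : ℕ) : ℂ) * a (i + 1) z)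
        (fun i z hz => ((ha (i + 1) z hz).const_mul _).congr_val (by ring)) ?_
      intro z hz
      have e := (hs (n + 1) z hz).unique ((HasD.const 0).congr_fun
        (Filter.eventually_of_mem (hB.mem_nhds hz) h))
      rw [Finset.sum_range_succ'] at e
      have e' : (∑ i ∈ Finset.range n, ((i + 1 : ℕ) : ℂ) * a (i + 1) z * X z ^ i) * r z = 0 := by
        rw [Finset.sum_mul, ← e]
        simp only [Nat.cast_zero, zero_mul, mul_zero, add_zero, Nat.add_sub_cancel]
        exact Finset.sum_congr rfl fun i _ => by ring
      exact (mul_eq_zero.mp e').resolve_right (hr z hz)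
    have h2 : ∀ i < n, ∀ z ∈ B, a (i + 1) z = 0 := fun i hi z hz =>
      (mul_eq_zero.mp (h1 i hi z hz)).resolve_left (by exact_mod_cast Nat.succ_ne_zero i)
    intro i hi z hz
    rcases i with _ | i
    · have e := h z hz
      rw [Finset.sum_range_succ', Finset.sum_eq_zero] at e
      · simpa using e
      · intro i hi
        rw [h2 i (Finset.mem_range.mp hi) z hz, zero_mul]
    · exact h2 i (by omega) z hz

end Derivation

/-! ### Motion of points along a fixed curve -/

section Motion

open Quartic

variable {E : Type*} [NormedAddCommGroup E] [NormedSpace ℝ E]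

/-- The curve and the square root `s` of its leading coefficient have derivative zero. -/
structure Fixed (T : (E →L[ℝ] ℂ) →ₗ[ℂ] ℂ) (z : E) (q : E → Quartic) (s : E → ℂ) : Prop where
  a₄ : HasD T z (fun w => (q w).a₄) 0
  a₃ : HasD T z (fun w => (q w).a₃) 0
  a₂ : HasD T z (fun w => (q w).a₂) 0
  a₁ : HasD T z (fun w => (q w).a₁) 0
  a₀ : HasD T z (fun w => (q w).a₀) 0
  root : HasD T z s 0
  sq : s z ^ 2 = (q z).a₄

/-- The point `P` moves along the curve with speed `r` with respect to `dx / y`. -/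
structure Moves (T : (E →L[ℝ] ℂ) →ₗ[ℂ] ℂ) (z : E) (q : E → Quartic) (P : E → ℂ × ℂ) (r : ℂ) :
    Prop where
  fst : HasD T z (fun w => (P w).1) (r * (P z).2)
  snd : HasD T z (fun w => (P w).2) (r * ((q z).f' (P z).1 / 2))
  on : (q z).OnCurve (P z)

variable {T : (E →L[ℝ] ℂ) →ₗ[ℂ] ℂ} {z : E} {q : E → Quartic} {s ℓ : E → ℂ} {P Q : E → ℂ × ℂ}
  {r r' : ℂ}

/-! ### The parabola through two moving points -/

/-- `𝒫(x)² - f(x) = (x - x_P)(x - x_Q) e(x)` for the parabola `𝒫` of `P`, `Q` and this linear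
polynomial `e`. -/
def residual (q : Quartic) (s ℓ : ℂ) (P Q : ℂ × ℂ) (x : ℂ) : ℂ :=
  q.sumDenom s ℓ P Q * (x + P.1 + Q.1) + (2 * b₀ s ℓ P Q * b₂ s + b₁ s ℓ P Q ^ 2 - q.a₂)

/-- The parabola of `P`, `Q` and `ℓ` meets the curve in `P`, `Q` with multiplicities: conditions on
the two lowest coefficients of `𝒫² - f`. -/
structure Secant (q : Quartic) (s ℓ : ℂ) (P Q : ℂ × ℂ) : Prop where
  slope : P.2 - Q.2 = ℓ * (P.1 - Q.1)
  coeff_one : q.a₁ = 2 * b₁ s ℓ P Q * b₀ s ℓ P Q - (P.1 * Q.1 * q.sumDenom s ℓ P Q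
    - (P.1 + Q.1) * residual q s ℓ P Q 0)
  coeff_zero : q.a₀ = b₀ s ℓ P Q ^ 2 - P.1 * Q.1 * residual q s ℓ P Q 0

/-- Since `s ^ 2 = a₄`, the polynomial 𝒫² - f has degree at most 3 and vanishes at both abscissas.
The difference of the two curve equations, divided by x_P - x_Q, gives the linear coefficient; the
equation of P then gives the constant one. -/
theorem secant_chord {q : Quartic} {s : ℂ} {P Q : ℂ × ℂ} (hs : s ^ 2 = q.a₄) (hP : q.OnCurve P)
    (hQ : q.OnCurve Q) (h : P.1 ≠ Q.1) : Secant q s (chordSlope P Q) P Q := by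
  have h' : P.1 - Q.1 ≠ 0 := sub_ne_zero.mpr h
  have hl : P.2 - Q.2 = chordSlope P Q * (P.1 - Q.1) := by
    rw [chordSlope, div_mul_cancel₀ _ h']
  generalize chordSlope P Q = l at hl
  obtain ⟨x, y⟩ := P
  obtain ⟨x', y'⟩ := Q
  simp only [OnCurve, Quartic.f] at *
  obtain rfl : y' = y - l * (x - x') := by linear_combination -hl
  have e1 : q.a₁ = 2 * b₁ s l (x, y) (x', y - l * (x - x')) * b₀ s l (x, y) (x', y - l * (x - x'))
      - (x * x' * q.sumDenom s l (x, y) (x', y - l * (x - x'))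
    - (x + x') * residual q s l (x, y) (x', y - l * (x - x')) 0) := by
    apply mul_left_cancel₀ h'
    simp only [residual, sumDenom, b₀, b₁, b₂]
    linear_combination hQ - hP + (x ^ 4 - x' ^ 4) * hs
  refine ⟨hl, e1, ?_⟩
  simp only [residual, sumDenom, b₀, b₁, b₂] at e1 ⊢
  linear_combination -hP + x ^ 4 * hs - x * e1

theorem secant_tangent {q : Quartic} {s : ℂ} {P : ℂ × ℂ} (hs : s ^ 2 = q.a₄) (hP : q.OnCurve P)
    (h : P.2 ≠ 0) : Secant q s (q.tangentSlope P) P P := by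
  have hl : q.f' P.1 = 2 * P.2 * q.tangentSlope P := by
    rw [tangentSlope]
    field_simp
  generalize q.tangentSlope P = l at hl
  obtain ⟨x, y⟩ := P
  simp only [OnCurve, Quartic.f, Quartic.f'] at *
  have e1 : q.a₁ = 2 * b₁ s l (x, y) (x, y) * b₀ s l (x, y) (x, y)
      - (x * x * q.sumDenom s l (x, y) (x, y) - (x + x) * residual q s l (x, y) (x, y) 0) := by
    simp only [residual, sumDenom, b₀, b₁, b₂]
    linear_combination hl + 4 * x ^ 3 * hs
  refine ⟨by ring, e1, ?_⟩
  simp only [residual, sumDenom, b₀, b₁, b₂] at e1 ⊢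
  linear_combination -hP + x ^ 4 * hs - x * e1

/-- The derivative of the slope of the secant through two moving points. -/
def slopeSpeed (q : Quartic) (s ℓ : ℂ) (P Q : ℂ × ℂ) (r r' : ℂ) : ℂ :=
  s * (r * P.2 + r' * Q.2) - (r * residual q s ℓ P Q P.1 + r' * residual q s ℓ P Q Q.1) / 2

/-- Differentiate 𝒫(x_P) = y_P: as 2 y_P 𝒫'(x_P) - f'(x_P) = (x_P - x_Q) e(x_P), the coefficientwise
derivative of 𝒫 takes at x_P the value -r (x_P - x_Q) e(x_P) / 2, and similarly at x_Q. It is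
linear, because `s` is fixed, so it equals -(r e(x_P)(x - x_Q) + r' e(x_Q)(x - x_P)) / 2. The
formulas for the derivatives of ℓ, `b₁` and `b₀` are read off from this. -/
theorem Moves.chordSlope (hF : Fixed T z q s) (hP : Moves T z q P r) (hQ : Moves T z q Q r')
    (h : (P z).1 ≠ (Q z).1) : HasD T z (fun w => chordSlope (P w) (Q w))
      (slopeSpeed (q z) (s z) (Quartic.chordSlope (P z) (Q z)) (P z) (Q z) r r') := by
  have h' : (P z).1 - (Q z).1 ≠ 0 := sub_ne_zero.mpr h
  have hS := secant_chord hF.sq hP.on hQ.on h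
  refine ((hP.snd.sub hQ.snd).div (hP.fst.sub hQ.fst) h').congr_val ?_
  rw [div_eq_iff h', hS.slope, mul_div_assoc, div_self h', mul_one]
  have e0 := hS.slope
  have e1 := hS.coeff_one
  have hs := hF.sq
  clear hS
  generalize Quartic.chordSlope (P z) (Q z) = l at *
  simp only [slopeSpeed, residual, sumDenom, b₀, b₁, b₂, Quartic.f'] at *
  generalize q z = q at *
  generalize s z = s at *
  have hy : (Q z).2 = (P z).2 - l * ((P z).1 - (Q z).1) := by linear_combination -e0
  rw [e1, hy, ← hs]
  ring

/-- The formula is that of the chord with Q = P, so doubling and addition can share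
`Moves.parabolaSum`. -/
theorem Moves.tangentSlope (hF : Fixed T z q s) (hP : Moves T z q P r)
    (h : (P z).2 ≠ 0) : HasD T z (fun w => (q w).tangentSlope (P w))
      (slopeSpeed (q z) (s z) ((q z).tangentSlope (P z)) (P z) (P z) r r) := by
  have hS := secant_tangent hF.sq hP.on h
  have hl : (q z).f' (P z).1 = 2 * (P z).2 * (q z).tangentSlope (P z) := by
    rw [Quartic.tangentSlope]
    field_simp
  have hd : HasD T z (fun w => (q w).f' (P w).1)
      ((12 * (q z).a₄ * (P z).1 ^ 2 + 6 * (q z).a₃ * (P z).1 + 2 * (q z).a₂) * (r * (P z).2)) := by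
    refine ((((hF.a₄.const_mul 4).mul (hP.fst.pow 3)).add
      ((hF.a₃.const_mul 3).mul (hP.fst.pow 2))).add
      ((hF.a₂.const_mul 2).mul hP.fst)).add hF.a₁ |>.congr_val ?_
    push_cast
    ring
  have h2 : 2 * (P z).2 ≠ 0 := mul_ne_zero two_ne_zero h
  refine (hd.div (hP.snd.const_mul 2) h2).congr_val ?_
  rw [div_eq_iff h2, ← Quartic.tangentSlope, hl]
  have e1 := hS.coeff_one
  have hs := hF.sq
  generalize (q z).tangentSlope (P z) = l at *
  simp only [slopeSpeed, residual, sumDenom, b₀, b₁, b₂, Quartic.f'] at *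
  generalize q z = q at *
  generalize s z = s at *
  rw [← hs]
  ring

theorem hasD_b₁ (hF : Fixed T z q s) (hP : Moves T z q P r) (hQ : Moves T z q Q r')
    (hℓ : HasD T z ℓ (slopeSpeed (q z) (s z) (ℓ z) (P z) (Q z) r r')) :
    HasD T z (fun w => b₁ (s w) (ℓ w) (P w) (Q w))
      (-(r * residual (q z) (s z) (ℓ z) (P z) (Q z) (P z).1
        + r' * residual (q z) (s z) (ℓ z) (P z) (Q z) (Q z).1) / 2) :=
  (hℓ.sub (hF.root.mul (hP.fst.add hQ.fst))).congr_val (by simp only [slopeSpeed]; ring)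

theorem hasD_b₀ (hF : Fixed T z q s) (hP : Moves T z q P r) (hQ : Moves T z q Q r')
    (hS : Secant (q z) (s z) (ℓ z) (P z) (Q z))
    (hℓ : HasD T z ℓ (slopeSpeed (q z) (s z) (ℓ z) (P z) (Q z) r r')) :
    HasD T z (fun w => b₀ (s w) (ℓ w) (P w) (Q w))
      ((r * residual (q z) (s z) (ℓ z) (P z) (Q z) (P z).1 * (Q z).1
        + r' * residual (q z) (s z) (ℓ z) (P z) (Q z) (Q z).1 * (P z).1) / 2) := by
  refine ((((hF.root.mul hP.fst).mul hQ.fst).sub (hℓ.mul hP.fst)).add hP.snd).congr_val ?_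
  have e0 := hS.slope
  have e1 := hS.coeff_one
  have hs := hF.sq
  simp only [slopeSpeed, residual, sumDenom, b₀, b₁, b₂, Quartic.f'] at *
  generalize q z = q at *
  generalize s z = s at *
  generalize ℓ z = l at *
  have hy : (Q z).2 = (P z).2 - l * ((P z).1 - (Q z).1) := by linear_combination -e0
  rw [e1, hy, ← hs]
  ring

theorem hasD_sumDenom (hF : Fixed T z q s) (hP : Moves T z q P r) (hQ : Moves T z q Q r')
    (hℓ : HasD T z ℓ (slopeSpeed (q z) (s z) (ℓ z) (P z) (Q z) r r')) :
    HasD T z (fun w => (q w).sumDenom (s w) (ℓ w) (P w) (Q w))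
      (-(s z) * (r * residual (q z) (s z) (ℓ z) (P z) (Q z) (P z).1
        + r' * residual (q z) (s z) (ℓ z) (P z) (Q z) (Q z).1)) :=
  ((((hasD_b₁ hF hP hQ hℓ).const_mul 2).mul hF.root).sub hF.a₃).congr_val (by ring)

theorem parabolaSum_snd (q : Quartic) (s ℓ : ℂ) (P Q : ℂ × ℂ) :
    (q.parabolaSum s ℓ P Q).2 = -(s * (q.parabolaSum s ℓ P Q).1 ^ 2
      + b₁ s ℓ P Q * (q.parabolaSum s ℓ P Q).1 + b₀ s ℓ P Q) := rfl

theorem residual_eq {q : Quartic} {s ℓ : ℂ} {P Q : ℂ × ℂ} (h : q.sumDenom s ℓ P Q ≠ 0) (x : ℂ) :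
    residual q s ℓ P Q x = q.sumDenom s ℓ P Q * (x - (q.parabolaSum s ℓ P Q).1) := by
  simp only [residual, Quartic.parabolaSum]
  field_simp
  ring

/-- Abel's theorem for dx/y. With e(x) = d (x - x₃), the derivative of 𝒫 takes at x₃ the value
(d/2)(r + r')(x₃ - x_P)(x₃ - x_Q), while (𝒫² - f)'(x₃) = d (x₃ - x_P)(x₃ - x_Q); so x₃ has
derivative -(r + r') 𝒫(x₃). The proof verifies this on the explicit formulas, which avoids dividing
by x₃ - x_P and x₃ - x_Q. -/
theorem Moves.parabolaSum (hF : Fixed T z q s) (hP : Moves T z q P r) (hQ : Moves T z q Q r')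
    (hS : Secant (q z) (s z) (ℓ z) (P z) (Q z))
    (hℓ : HasD T z ℓ (slopeSpeed (q z) (s z) (ℓ z) (P z) (Q z) r r'))
    (h : (q z).sumDenom (s z) (ℓ z) (P z) (Q z) ≠ 0) :
    Moves T z q (fun w => (q w).parabolaSum (s w) (ℓ w) (P w) (Q w)) (r + r') := by
  have h₁ := hasD_b₁ hF hP hQ hℓ
  have h₀ := hasD_b₀ hF hP hQ hS hℓ
  have hd := hasD_sumDenom hF hP hQ hℓ
  have hx : HasD T z (fun w => ((q w).parabolaSum (s w) (ℓ w) (P w) (Q w)).1)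
      ((r + r') * ((q z).parabolaSum (s z) (ℓ z) (P z) (Q z)).2) := by
    refine ((hP.fst.neg.sub hQ.fst).sub (((((h₀.const_mul 2).mul hF.root).add
      (h₁.pow 2)).sub hF.a₂).div hd h)).congr_val ?_
    rw [sub_eq_iff_eq_add, ← sub_eq_iff_eq_add', eq_div_iff h]
    have e : (2 * b₀ (s z) (ℓ z) (P z) (Q z) * s z + b₁ (s z) (ℓ z) (P z) (Q z) ^ 2 - (q z).a₂)
        / (q z).sumDenom (s z) (ℓ z) (P z) (Q z)
        = -(P z).1 - (Q z).1 - ((q z).parabolaSum (s z) (ℓ z) (P z) (Q z)).1 := by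
      simp only [Quartic.parabolaSum, b₂]
      ring
    rw [e, parabolaSum_snd, residual_eq h, residual_eq h, ← sub_eq_zero]
    generalize ((q z).parabolaSum (s z) (ℓ z) (P z) (Q z)).1 = x
    generalize (q z).sumDenom (s z) (ℓ z) (P z) (Q z) = d
    have hy : (Q z).2 = (P z).2 - ℓ z * ((P z).1 - (Q z).1) := by linear_combination -hS.slope
    simp only [b₀, b₁]
    rw [hy]
    push_cast
    ring
  have hy := (((hF.root.mul (hx.pow 2)).add (h₁.mul hx)).add h₀).neg
  refine ⟨hx, hy.congr_val ?_, ?_⟩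
  -- The coefficients of f are eliminated in favour of `b₀`, `b₁`, `s`, d and the abscissas, through
  -- f = 𝒫² - (x - x_P)(x - x_Q) d (x - x₃).
  · have e1 := hS.coeff_one
    have hs := hF.sq
    have e3 : (q z).a₃ = 2 * b₁ (s z) (ℓ z) (P z) (Q z) * s z
      - (q z).sumDenom (s z) (ℓ z) (P z) (Q z) := by
      simp only [sumDenom, b₂]
      ring
    have e2 := residual_eq h 0
    have e2' : (q z).a₂ = (q z).sumDenom (s z) (ℓ z) (P z) (Q z) * ((P z).1 + (Q z).1)
        + (2 * b₀ (s z) (ℓ z) (P z) (Q z) * s z + b₁ (s z) (ℓ z) (P z) (Q z) ^ 2)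
        - residual (q z) (s z) (ℓ z) (P z) (Q z) 0 := by
      simp only [residual, b₂]
      ring
    rw [e2] at e1 e2'
    rw [residual_eq h, residual_eq h]
    simp only [Quartic.f']
    rw [e1, e2', e3, parabolaSum_snd, ← hs]
    push_cast
    generalize ((q z).parabolaSum (s z) (ℓ z) (P z) (Q z)).1 = x
    generalize (q z).sumDenom (s z) (ℓ z) (P z) (Q z) = d
    ring
  · have e1 := hS.coeff_one
    have e0 := hS.coeff_zero
    have hs := hF.sq
    have e3 : (q z).a₃ = 2 * b₁ (s z) (ℓ z) (P z) (Q z) * s z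
      - (q z).sumDenom (s z) (ℓ z) (P z) (Q z) := by
      simp only [sumDenom, b₂]
      ring
    have e2 := residual_eq h 0
    have e2' : (q z).a₂ = (q z).sumDenom (s z) (ℓ z) (P z) (Q z) * ((P z).1 + (Q z).1)
        + (2 * b₀ (s z) (ℓ z) (P z) (Q z) * s z + b₁ (s z) (ℓ z) (P z) (Q z) ^ 2)
        - residual (q z) (s z) (ℓ z) (P z) (Q z) 0 := by
      simp only [residual, b₂]
      ring
    rw [e2] at e1 e0 e2'
    rw [OnCurve, Quartic.f, e0, e1, e2', e3, parabolaSum_snd, ← hs]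
    generalize ((q z).parabolaSum (s z) (ℓ z) (P z) (Q z)).1 = x
    generalize (q z).sumDenom (s z) (ℓ z) (P z) (Q z) = d
    ring

theorem Moves.add (hF : Fixed T z q s) (hP : Moves T z q P r) (hQ : Moves T z q Q r')
    (h : (q z).AddDefined (s z) (P z) (Q z)) :
    Moves T z q (fun w => (q w).add (s w) (P w) (Q w)) (r + r') :=
  Moves.parabolaSum hF hP hQ (secant_chord hF.sq hP.on hQ.on h.1) (hP.chordSlope hF hQ h.1) h.2

theorem Moves.double (hF : Fixed T z q s) (hP : Moves T z q P r)
    (h : (q z).DoubleDefined (s z) (P z)) :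
    Moves T z q (fun w => (q w).double (s w) (P w)) (r + r) :=
  Moves.parabolaSum hF hP hP (secant_tangent hF.sq hP.on h.1) (hP.tangentSlope hF h.1) h.2

/-- Multiples of a moving point move with multiples of its speed. -/
theorem Moves.mult (hF : Fixed T z q s) (hP : Moves T z q P r) :
    ∀ m : ℕ, (q z).MultDefined (s z) m (P z) →
      Moves T z q (fun w => (q w).mult (s w) m (P w)) (m * r)
  | 0, h => h.elim
  | 1, _ => by simpa [Quartic.mult] using hP
  | 2, h => by
    have := hP.double hF h
    rw [← two_mul] at this
    exact this
  | (n + 3), h => by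
    have := (Moves.mult hF hP (n + 2) h.1).add hF hP h.2
    have e : ((n + 2 : ℕ) : ℂ) * r + r = ((n + 3 : ℕ) : ℂ) * r := by
      push_cast
      ring
    rw [e] at this
    exact this

/-- The derivative of Euler's integral when the first point moves with unit speed. -/
def eulerSpeed (q : Quartic) (s : ℂ) (P Q : ℂ × ℂ) : ℂ :=
  q.sumDenom s (Quartic.chordSlope P Q) P Q * P.2
    - Quartic.chordSlope P Q * residual q s (Quartic.chordSlope P Q) P Q P.1

/-- The factor r + r' expresses Euler's theorem: the integral does not change when the points move
with opposite speeds, which keeps their sum fixed. -/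
theorem hasD_euler (hF : Fixed T z q s) (hP : Moves T z q P r) (hQ : Moves T z q Q r')
    (h : (P z).1 ≠ (Q z).1) :
    HasD T z (fun w => Quartic.chordSlope (P w) (Q w) ^ 2
      - (q w).a₄ * ((P w).1 + (Q w).1) ^ 2 - (q w).a₃ * ((P w).1 + (Q w).1))
      ((r + r') * eulerSpeed (q z) (s z) (P z) (Q z)) := by
  refine ((((hP.chordSlope hF hQ h).pow 2).sub (hF.a₄.mul ((hP.fst.add hQ.fst).pow 2))).sub
    (hF.a₃.mul (hP.fst.add hQ.fst))).congr_val ?_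
  have hS := (secant_chord hF.sq hP.on hQ.on h).slope
  have hs := hF.sq
  rw [eulerSpeed]
  generalize Quartic.chordSlope (P z) (Q z) = l at *
  have hy : (Q z).2 = (P z).2 - l * ((P z).1 - (Q z).1) := by linear_combination -hS
  simp only [slopeSpeed, residual, sumDenom, b₀, b₁, b₂]
  rw [hy, ← hs]
  push_cast
  ring

theorem hasD_eulerIntegral (hF : Fixed T z q s) (hP : Moves T z q P r) (hQ : Moves T z q Q r')
    {m n : ℕ} (h : (q z).EulerDefined (s z) m n (P z) (Q z)) :
    HasD T z (fun w => (q w).eulerIntegral (s w) m n (P w) (Q w))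
      ((m * r + n * r') * eulerSpeed (q z) (s z) ((q z).mult (s z) m (P z))
        ((q z).mult (s z) n (Q z))) :=
  hasD_euler hF (hP.mult hF m h.1) (hQ.mult hF n h.2.1) h.2.2

end Motion

/-! ### Denominators do not vanish identically on open sets -/

section Generic

open Quartic Topology

theorem exists_open_subset {E : Type*} [TopologicalSpace E] {B : Set E} {z : E}
    (hB : IsOpen B) (hz : z ∈ B) {p : E → Prop} (h : ∀ᶠ w in 𝓝 z, p w) :
    ∃ B' ⊆ B, IsOpen B' ∧ B'.Nonempty ∧ ∀ w ∈ B', p w := by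
  obtain ⟨t, ht, hto, hzt⟩ := mem_nhds_iff.mp (Filter.inter_mem (hB.mem_nhds hz) h)
  exact ⟨t, fun w hw => (ht hw).1, hto, ⟨z, hzt⟩, fun w hw => (ht hw).2⟩

variable {E : Type*} [NormedAddCommGroup E] [NormedSpace ℝ E]

/-- A moving point of a nonsingular curve that is not a branch point. -/
structure Generic (T : (E →L[ℝ] ℂ) →ₗ[ℂ] ℂ) (z : E) (q : E → Quartic) (s : E → ℂ)
    (P : E → ℂ × ℂ) (r : ℂ) : Prop where
  fixed : Fixed T z q s
  moves : Moves T z q P r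
  speed : r ≠ 0
  ordinate : (P z).2 ≠ 0
  nonsingular : ∀ x, (q z).f x = 0 → (q z).f' x ≠ 0
  root : ∃ x, (q z).f x = 0
  leading : s z ≠ 0 ∨ (q z).a₃ ≠ 0

variable {T : (E →L[ℝ] ℂ) →ₗ[ℂ] ℂ} {z : E} {D D' : E → (E →L[ℝ] ℂ) →ₗ[ℂ] ℂ} {q : E → Quartic}
  {s : E → ℂ} {P Q : E → ℂ × ℂ} {r r' : ℂ} {B : Set E}

theorem HasD.unique_on {F G : E → ℂ} {c d : ℂ} (hB : IsOpen B) (hz : z ∈ B)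
    (hF : HasD T z F c) (hG : HasD T z G d) (h : ∀ w ∈ B, F w = G w) : c = d :=
  hF.unique (hG.congr_fun (Filter.eventually_of_mem (hB.mem_nhds hz) h))

/-! ### Openness of the nonvanishing conditions -/

theorem eventually_addDefined (hF : Fixed T z q s) (hP : Moves T z q P r) (hQ : Moves T z q Q r')
    (h : (q z).AddDefined (s z) (P z) (Q z)) :
    ∀ᶠ w in 𝓝 z, (q w).AddDefined (s w) (P w) (Q w) := by
  have h1 := (hP.fst.sub hQ.fst).continuousAt.eventually_ne (sub_ne_zero.mpr h.1)
  have h2 := (hasD_sumDenom hF hP hQ (hP.chordSlope hF hQ h.1)).continuousAt.eventually_ne h.2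
  filter_upwards [h1, h2] with w h1 h2
  exact ⟨sub_ne_zero.mp h1, h2⟩

theorem eventually_doubleDefined (hF : Fixed T z q s) (hP : Moves T z q P r)
    (h : (q z).DoubleDefined (s z) (P z)) : ∀ᶠ w in 𝓝 z, (q w).DoubleDefined (s w) (P w) := by
  have h1 := hP.snd.continuousAt.eventually_ne h.1
  have h2 := (hasD_sumDenom hF hP hP (hP.tangentSlope hF h.1)).continuousAt.eventually_ne h.2
  filter_upwards [h1, h2] with w h1 h2
  exact ⟨h1, h2⟩

theorem eventually_multDefined (hF : Fixed T z q s) (hP : Moves T z q P r) :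
    ∀ m, (q z).MultDefined (s z) m (P z) → ∀ᶠ w in 𝓝 z, (q w).MultDefined (s w) m (P w)
  | 0, h => h.elim
  | 1, _ => Filter.Eventually.of_forall fun _ => trivial
  | 2, h => eventually_doubleDefined hF hP h
  | (n + 3), h => (eventually_multDefined hF hP (n + 2) h.1).and
      (eventually_addDefined hF (hP.mult hF (n + 2) h.1) hP h.2)

theorem eventually_eulerDefined (hF : Fixed T z q s) (hP : Moves T z q P r)
    (hQ : Moves T z q Q r') {m n : ℕ} (h : (q z).EulerDefined (s z) m n (P z) (Q z)) :
    ∀ᶠ w in 𝓝 z, (q w).EulerDefined (s w) m n (P w) (Q w) := by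
  have h1 := ((hP.mult hF m h.1).fst.sub (hQ.mult hF n h.2.1).fst).continuousAt.eventually_ne
    (sub_ne_zero.mpr h.2.2)
  filter_upwards [eventually_multDefined hF hP m h.1, eventually_multDefined hF hQ n h.2.1, h1]
    with w h2 h3 h1
  exact ⟨h2, h3, sub_ne_zero.mp h1⟩

theorem continuousAt_eulerSpeed (hF : Fixed T z q s) (hP : Moves T z q P r)
    (hQ : Moves T z q Q r') (h : (P z).1 ≠ (Q z).1) :
    ContinuousAt (fun w => eulerSpeed (q w) (s w) (P w) (Q w)) z := by
  have hl := hP.chordSlope hF hQ h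
  have hd := hasD_sumDenom hF hP hQ hl
  have h0 := hasD_b₀ hF hP hQ (secant_chord hF.sq hP.on hQ.on h) hl
  have h1 := hasD_b₁ hF hP hQ hl
  have hr := (hd.mul ((hP.fst.add hP.fst).add hQ.fst)).add
    ((((h0.const_mul 2).mul hF.root).add (h1.pow 2)).sub hF.a₂)
  exact ((hd.mul hP.snd).sub (hl.mul hr)).continuousAt

/-- A moving point of a nonsingular curve is not always a branch point. -/
theorem exists_ordinate_ne_zero (hB : IsOpen B) (hne : B.Nonempty)
    (hP : ∀ z ∈ B, Moves (D z) z q P r) (hr : r ≠ 0)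
    (hs : ∀ z ∈ B, ∀ x, (q z).f x = 0 → (q z).f' x ≠ 0) : ∃ z ∈ B, (P z).2 ≠ 0 := by
  by_contra! h
  obtain ⟨z, hz⟩ := hne
  have e := HasD.unique_on hB hz (hP z hz).snd (HasD.const 0) h
  have hon := (hP z hz).on
  rw [OnCurve, h z hz] at hon
  exact hs z hz _ (by simpa using hon.symm) (by simpa [hr] using e)

/-! ### Definedness of the multiples, through the Weierstrass model -/

/-- A function with a double pole at one of the points at infinity of the curve. -/
def pole (q : Quartic) (s : ℂ) (P : ℂ × ℂ) : ℂ := 2 * s * P.2 - 2 * s ^ 2 * P.1 ^ 2 - q.a₃ * P.1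

/-- The derivative of `pole` with respect to `dx / y`. -/
def poleSpeed (q : Quartic) (s : ℂ) (P : ℂ × ℂ) : ℂ :=
  s * q.f' P.1 - (4 * s ^ 2 * P.1 + q.a₃) * P.2

theorem hasD_pole (hF : Fixed T z q s) (hP : Moves T z q P r) :
    HasD T z (fun w => pole (q w) (s w) (P w)) (r * poleSpeed (q z) (s z) (P z)) := by
  refine ((((hF.root.const_mul 2).mul hP.snd).sub
    (((hF.root.pow 2).const_mul 2).mul (hP.fst.pow 2))).sub (hF.a₃.mul hP.fst)).congr_val ?_
  rw [poleSpeed]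
  push_cast
  ring

/-- The Weierstrass equation of the curve. -/
theorem poleSpeed_sq {q : Quartic} {s : ℂ} {P : ℂ × ℂ} (hs : s ^ 2 = q.a₄) (hP : q.OnCurve P) :
    poleSpeed q s P ^ 2 = -pole q s P ^ 3 + q.a₂ * pole q s P ^ 2
      + (4 * s ^ 2 * q.a₀ - q.a₁ * q.a₃) * pole q s P
      + (s ^ 2 * q.a₁ ^ 2 + q.a₃ ^ 2 * q.a₀ - 4 * s ^ 2 * q.a₀ * q.a₂) := by
  have e0 : q.a₀ = P.2 ^ 2 - (s ^ 2 * P.1 ^ 4 + q.a₃ * P.1 ^ 3 + q.a₂ * P.1 ^ 2 + q.a₁ * P.1) := by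
    rw [OnCurve, Quartic.f] at hP
    rw [hs]
    linear_combination -hP
  simp only [poleSpeed, pole, Quartic.f']
  rw [e0, ← hs]
  ring

/-- The coefficients of a quadratic polynomial. -/
def quadraticCoeff (a b c : E → ℂ) : ℕ → E → ℂ
  | 0 => a
  | 1 => b
  | 2 => c
  | _ => fun _ => 0

/-- Otherwise t = `pole` has derivative zero. Eliminating y gives (t + 2s²x² + a₃x)² = 4s² f(x),
where the terms in x⁴ and x³ cancel, so a quadratic relation with constant coefficients is left and
must be trivial. Thus 4s² f is the square of a polynomial. -/
theorem exists_poleSpeed_ne_zero (hB : IsOpen B) (hne : B.Nonempty)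
    (hG : ∀ z ∈ B, Generic (D z) z q s P r) : ∃ z ∈ B, poleSpeed (q z) (s z) (P z) ≠ 0 := by
  by_contra! h
  have hh : ∀ z ∈ B, HasD (D z) z (fun w => pole (q w) (s w) (P w)) 0 := fun z hz =>
    (hasD_pole (hG z hz).fixed (hG z hz).moves).congr_val (by rw [h z hz, mul_zero])
  have key := coeff_eq_zero_of_sum_eq_zero hB (fun z hz => (hG z hz).moves.fst)
    (fun z hz => mul_ne_zero (hG z hz).speed (hG z hz).ordinate) 3
    (quadraticCoeff (fun w => pole (q w) (s w) (P w) ^ 2 - 4 * s w ^ 2 * (q w).a₀)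
      (fun w => 2 * pole (q w) (s w) (P w) * (q w).a₃ - 4 * s w ^ 2 * (q w).a₁)
      (fun w => (q w).a₃ ^ 2 + 4 * s w ^ 2 * pole (q w) (s w) (P w) - 4 * s w ^ 2 * (q w).a₂))
    (fun i z hz => by
      have hF := (hG z hz).fixed
      have hs := (hF.root.pow 2).const_mul 4
      match i with
      | 0 => exact (((hh z hz).pow 2).sub (hs.mul hF.a₀)).congr_val (by simp)
      | 1 => exact ((((hh z hz).const_mul 2).mul hF.a₃).sub (hs.mul hF.a₁)).congr_val (by simp)
      | 2 => exact (((hF.a₃.pow 2).add (hs.mul (hh z hz))).sub (hs.mul hF.a₂)).congr_val (by simp)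
      | (n + 3) => exact HasD.const 0)
    (fun z hz => by
      have hP := (hG z hz).moves.on
      have hs := (hG z hz).fixed.sq
      rw [OnCurve, Quartic.f, ← hs] at hP
      simp only [Finset.sum_range_succ, Finset.range_zero, Finset.sum_empty, quadraticCoeff, pole]
      linear_combination (4 * s z ^ 2) * hP)
  obtain ⟨z, hz⟩ := hne
  have e0 := key 0 (by norm_num) z hz
  have e1 := key 1 (by norm_num) z hz
  have e2 := key 2 (by norm_num) z hz
  simp only [quadraticCoeff] at e0 e1 e2
  have hg := hG z hz
  have hs := hg.fixed.sq
  obtain ⟨x, hx⟩ := hg.root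
  have hx' := hg.nonsingular x hx
  simp only [Quartic.f, Quartic.f', ← hs] at hx hx'
  generalize pole (q z) (s z) (P z) = t at *
  -- A root of f is a root of the squared polynomial, hence a double root of s² f; as it is a simple
  -- root of f, s = 0. Then the quadratic coefficient reduces to a₃², against `leading`.
  have h1 : t + 2 * s z ^ 2 * x ^ 2 + (q z).a₃ * x = 0 := by
    refine pow_eq_zero_iff two_ne_zero |>.mp ?_
    linear_combination e0 + x * e1 + x ^ 2 * e2 + 4 * s z ^ 2 * hx
  have h2 : s z ^ 2 * (4 * s z ^ 2 * x ^ 3 + 3 * (q z).a₃ * x ^ 2 + 2 * (q z).a₂ * x + (q z).a₁)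
      = 0 := by
    linear_combination (-1 / 4) * e1 - x / 2 * e2 + (4 * s z ^ 2 * x + (q z).a₃) / 2 * h1
  have h3 : s z = 0 := by simpa [hx'] using h2
  rcases hg.leading with h4 | h4
  · exact h4 h3
  · simp [h3, h4] at e2

/-- On the tangent parabola, `poleSpeed` is y times the denominator of the doubling formula. -/
theorem exists_doubleDefined (hB : IsOpen B) (hne : B.Nonempty)
    (hG : ∀ z ∈ B, Generic (D z) z q s P r) : ∃ z ∈ B, (q z).DoubleDefined (s z) (P z) := by
  obtain ⟨z, hz, h⟩ := exists_poleSpeed_ne_zero hB hne hG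
  have hy := (hG z hz).ordinate
  refine ⟨z, hz, hy, fun h0 => h ?_⟩
  have hl : (q z).f' (P z).1 = 2 * (P z).2 * (q z).tangentSlope (P z) := by
    rw [Quartic.tangentSlope]
    field_simp
  simp only [sumDenom, b₁, b₂] at h0
  rw [poleSpeed, hl]
  linear_combination (P z).2 * h0

/-- If the abscissas agreed identically, the ordinates would agree up to sign while differentiation
gives m y_Q = y_P, so (m² - 1) y_P² = 0. The denominator times x_Q - x_P is the difference of the
values of `pole`, so its vanishing is refuted in the same way with `pole`, `poleSpeed` and the
Weierstrass equation in place of x, y and the quartic. -/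
theorem exists_addDefined {m : ℕ} (hm : 2 ≤ m) (hB : IsOpen B) (hne : B.Nonempty)
    (hG : ∀ z ∈ B, Generic (D z) z q s P r) (hQ : ∀ z ∈ B, Moves (D z) z q Q (m * r)) :
    ∃ z ∈ B, (q z).AddDefined (s z) (Q z) (P z) := by
  have hm1 : (m : ℂ) ^ 2 - 1 ≠ 0 := by
    rw [sub_ne_zero]
    norm_cast
    nlinarith
  have hx : ∃ z ∈ B, (Q z).1 ≠ (P z).1 := by
    by_contra! h
    obtain ⟨z, hz⟩ := hne
    have hg := hG z hz
    have e := HasD.unique_on hB hz (hQ z hz).fst hg.moves.fst h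
    have e1 : (m : ℂ) * (Q z).2 = (P z).2 := mul_left_cancel₀ hg.speed (by linear_combination e)
    have e2 : (Q z).2 ^ 2 = (P z).2 ^ 2 := by rw [(hQ z hz).on, hg.moves.on, h z hz]
    have e3 : ((m : ℂ) ^ 2 - 1) * (P z).2 ^ 2 = 0 := by
      rw [← e1] at e2 ⊢
      linear_combination (-(m : ℂ) ^ 2) * e2
    simp [hm1, hg.ordinate] at e3
  obtain ⟨z₀, hz₀, hx⟩ := hx
  obtain ⟨B', hB', hBo, hBn, hx⟩ := exists_open_subset hB hz₀
    (((hQ z₀ hz₀).fst.sub (hG z₀ hz₀).moves.fst).continuousAt.eventually_ne (sub_ne_zero.mpr hx))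
  by_contra! h
  have hp : ∀ z ∈ B', pole (q z) (s z) (Q z) = pole (q z) (s z) (P z) := by
    intro z hz
    have h0 := hx z hz
    have h1 : (q z).sumDenom (s z) (Quartic.chordSlope (Q z) (P z)) (Q z) (P z) = 0 := by
      by_contra h1
      exact h z (hB' hz) ⟨sub_ne_zero.mp h0, h1⟩
    have hl : (Q z).2 - (P z).2 = Quartic.chordSlope (Q z) (P z) * ((Q z).1 - (P z).1) := by
      rw [Quartic.chordSlope, div_mul_cancel₀ _ h0]
    simp only [sumDenom, b₁, b₂] at h1
    rw [pole, pole]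
    linear_combination 2 * s z * hl + ((Q z).1 - (P z).1) * h1
  obtain ⟨z, hz, h0⟩ := exists_poleSpeed_ne_zero hBo hBn fun z hz => hG z (hB' hz)
  have hg := hG z (hB' hz)
  have e := HasD.unique_on hBo hz (hasD_pole hg.fixed (hQ z (hB' hz)))
    (hasD_pole hg.fixed hg.moves) hp
  have e1 : (m : ℂ) * poleSpeed (q z) (s z) (Q z) = poleSpeed (q z) (s z) (P z) :=
    mul_left_cancel₀ hg.speed (by linear_combination e)
  have e2 : poleSpeed (q z) (s z) (Q z) ^ 2 = poleSpeed (q z) (s z) (P z) ^ 2 := by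
    rw [poleSpeed_sq hg.fixed.sq (hQ z (hB' hz)).on, poleSpeed_sq hg.fixed.sq hg.moves.on, hp z hz]
  have e3 : ((m : ℂ) ^ 2 - 1) * poleSpeed (q z) (s z) (P z) ^ 2 = 0 := by
    rw [← e1] at e2 ⊢
    linear_combination (-(m : ℂ) ^ 2) * e2
  simp [hm1, h0] at e3

/-- Multiples of a moving point are defined on an open subset of any open set. -/
theorem exists_multDefined (hB : IsOpen B) (hne : B.Nonempty)
    (hG : ∀ z ∈ B, Generic (D z) z q s P r) :
    ∀ m : ℕ, 0 < m →
      ∃ B' ⊆ B, IsOpen B' ∧ B'.Nonempty ∧ ∀ z ∈ B', (q z).MultDefined (s z) m (P z)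
  | 0, h => absurd h (lt_irrefl 0)
  | 1, _ => ⟨B, subset_rfl, hB, hne, fun _ _ => trivial⟩
  | 2, _ => by
    obtain ⟨z, hz, h⟩ := exists_doubleDefined hB hne hG
    exact exists_open_subset hB hz (eventually_doubleDefined (hG z hz).fixed (hG z hz).moves h)
  | (n + 3), _ => by
    obtain ⟨B₁, hs₁, ho₁, hn₁, h₁⟩ := exists_multDefined hB hne hG (n + 2) (by omega)
    have hG₁ := fun z hz => hG z (hs₁ hz)
    have hQ := fun z hz => (hG₁ z hz).moves.mult (hG₁ z hz).fixed (n + 2) (h₁ z hz)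
    obtain ⟨z, hz, h⟩ := exists_addDefined (m := n + 2) (by omega) ho₁ hn₁ hG₁ hQ
    obtain ⟨B₂, hs₂, ho₂, hn₂, h₂⟩ := exists_open_subset ho₁ hz
      (eventually_addDefined (hG₁ z hz).fixed (hQ z hz) (hG₁ z hz).moves h)
    exact ⟨B₂, hs₂.trans hs₁, ho₂, hn₂, fun z hz => ⟨h₁ z (hs₂ hz), h₂ z hz⟩⟩

/-! ### Nonconstancy of Euler's integral -/

/-- The coefficients of a quartic polynomial. -/
def quarticCoeff (a b c d e : E → ℂ) : ℕ → E → ℂ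
  | 0 => a
  | 1 => b
  | 2 => c
  | 3 => d
  | 4 => e
  | _ => fun _ => 0

/-- Euler's integral of a moving and a resting point is not constant. -/
theorem exists_eulerSpeed_ne_zero (hB : IsOpen B) (hne : B.Nonempty)
    (hF : ∀ z ∈ B, Fixed (D z) z q s) (hP : ∀ z ∈ B, Moves (D z) z q P r)
    (hQ : ∀ z ∈ B, Moves (D z) z q Q 0) (hr : r ≠ 0) (hy : ∀ z ∈ B, (P z).2 ≠ 0)
    (hy' : ∀ z ∈ B, (Q z).2 ≠ 0) (hs : ∀ z ∈ B, ∀ x, (q z).f x = 0 → (q z).f' x ≠ 0)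
    (he : ∀ z ∈ B, ∃ x, (q z).f x = 0) (hx : ∀ z ∈ B, (P z).1 ≠ (Q z).1) :
    ∃ z ∈ B, eulerSpeed (q z) (s z) (P z) (Q z) ≠ 0 := by
  by_contra! h
  set C : E → ℂ := fun w => Quartic.chordSlope (P w) (Q w) ^ 2
      - (q w).a₄ * ((P w).1 + (Q w).1) ^ 2 - (q w).a₃ * ((P w).1 + (Q w).1) with hCdef
  have hC : ∀ z ∈ B, HasD (D z) z C 0 := fun z hz =>
    (hasD_euler (hF z hz) (hP z hz) (hQ z hz) (hx z hz)).congr_val (by rw [h z hz, mul_zero])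
  have hX : ∀ z ∈ B, HasD (D z) z (fun w => (Q w).1) 0 := fun z hz =>
    (hQ z hz).fst.congr_val (zero_mul _)
  have hY : ∀ z ∈ B, HasD (D z) z (fun w => (Q w).2) 0 := fun z hz =>
    (hQ z hz).snd.congr_val (zero_mul _)
  -- Clearing the denominator in the definition of `C` gives -2 y_P y_Q = c₂ x_P² + c₁ x_P + c₀. All
  -- c's have derivative zero, so after squaring, 4 y_Q² f is identically the square of a quadratic
  -- polynomial, which is impossible for f with a simple root.
  set c₂ : E → ℂ := fun w => C w - 2 * (q w).a₄ * (Q w).1 ^ 2 - (q w).a₃ * (Q w).1 - (q w).a₂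
    with hc₂
  set c₁ : E → ℂ := fun w => -2 * C w * (Q w).1 - (q w).a₃ * (Q w).1 ^ 2 - (q w).a₁ with hc₁
  set c₀ : E → ℂ := fun w => C w * (Q w).1 ^ 2 + (q w).a₄ * (Q w).1 ^ 4 + (q w).a₃ * (Q w).1 ^ 3
    - (q w).a₀ - (Q w).2 ^ 2 with hc₀
  have h₂ : ∀ z ∈ B, HasD (D z) z c₂ 0 := fun z hz =>
    ((((hC z hz).sub (((hF z hz).a₄.const_mul 2).mul ((hX z hz).pow 2))).sub
      ((hF z hz).a₃.mul (hX z hz))).sub (hF z hz).a₂).congr_val (by simp)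
  have h₁ : ∀ z ∈ B, HasD (D z) z c₁ 0 := fun z hz =>
    (((((hC z hz).const_mul (-2)).mul (hX z hz)).sub
      ((hF z hz).a₃.mul ((hX z hz).pow 2))).sub (hF z hz).a₁).congr_val (by simp)
  have h₀ : ∀ z ∈ B, HasD (D z) z c₀ 0 := fun z hz =>
    ((((((hC z hz).mul ((hX z hz).pow 2)).add ((hF z hz).a₄.mul ((hX z hz).pow 4))).add
      ((hF z hz).a₃.mul ((hX z hz).pow 3))).sub (hF z hz).a₀).sub
      ((hY z hz).pow 2)).congr_val (by simp)
  have key := coeff_eq_zero_of_sum_eq_zero hB (fun z hz => (hP z hz).fst)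
    (fun z hz => mul_ne_zero hr (hy z hz)) 5
    (quarticCoeff (fun w => 4 * (Q w).2 ^ 2 * (q w).a₀ - c₀ w ^ 2)
      (fun w => 4 * (Q w).2 ^ 2 * (q w).a₁ - 2 * c₁ w * c₀ w)
      (fun w => 4 * (Q w).2 ^ 2 * (q w).a₂ - (c₁ w ^ 2 + 2 * c₂ w * c₀ w))
      (fun w => 4 * (Q w).2 ^ 2 * (q w).a₃ - 2 * c₂ w * c₁ w)
      (fun w => 4 * (Q w).2 ^ 2 * (q w).a₄ - c₂ w ^ 2))
    (fun i z hz => by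
      have hy := ((hY z hz).pow 2).const_mul 4
      match i with
      | 0 => exact ((hy.mul (hF z hz).a₀).sub ((h₀ z hz).pow 2)).congr_val (by simp)
      | 1 => exact ((hy.mul (hF z hz).a₁).sub
          (((h₁ z hz).const_mul 2).mul (h₀ z hz))).congr_val (by simp)
      | 2 => exact ((hy.mul (hF z hz).a₂).sub (((h₁ z hz).pow 2).add
          (((h₂ z hz).const_mul 2).mul (h₀ z hz)))).congr_val (by simp)
      | 3 => exact ((hy.mul (hF z hz).a₃).sub
          (((h₂ z hz).const_mul 2).mul (h₁ z hz))).congr_val (by simp)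
      | 4 => exact ((hy.mul (hF z hz).a₄).sub ((h₂ z hz).pow 2)).congr_val (by simp)
      | (n + 5) => exact HasD.const 0)
    (fun z hz => by
      have hp := (hP z hz).on
      have hl : (P z).2 - (Q z).2 = Quartic.chordSlope (P z) (Q z) * ((P z).1 - (Q z).1) := by
        rw [Quartic.chordSlope, div_mul_cancel₀ _ (sub_ne_zero.mpr (hx z hz))]
      have e : -2 * (P z).2 * (Q z).2 = c₂ z * (P z).1 ^ 2 + c₁ z * (P z).1 + c₀ z := by
        rw [OnCurve, Quartic.f] at hp
        simp only [hc₂, hc₁, hc₀, hCdef]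
        linear_combination -hp + ((P z).2 - (Q z).2 +
          Quartic.chordSlope (P z) (Q z) * ((P z).1 - (Q z).1)) * hl
      rw [OnCurve, Quartic.f] at hp
      simp only [Finset.sum_range_succ, Finset.range_zero, Finset.sum_empty, quarticCoeff]
      linear_combination (-4 * (Q z).2 ^ 2) * hp + (-2 * (P z).2 * (Q z).2 +
        (c₂ z * (P z).1 ^ 2 + c₁ z * (P z).1 + c₀ z)) * e)
  obtain ⟨z, hz⟩ := hne
  have e0 := key 0 (by norm_num) z hz
  have e1 := key 1 (by norm_num) z hz
  have e2 := key 2 (by norm_num) z hz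
  have e3 := key 3 (by norm_num) z hz
  have e4 := key 4 (by norm_num) z hz
  simp only [quarticCoeff] at e0 e1 e2 e3 e4
  obtain ⟨x, hfx⟩ := he z hz
  have hfx' := hs z hz x hfx
  rw [Quartic.f] at hfx
  have g1 : c₂ z * x ^ 2 + c₁ z * x + c₀ z = 0 := by
    refine pow_eq_zero_iff two_ne_zero |>.mp ?_
    linear_combination 4 * (Q z).2 ^ 2 * hfx - e0 - x * e1 - x ^ 2 * e2 - x ^ 3 * e3 - x ^ 4 * e4
  have g2 : 4 * (Q z).2 ^ 2 * (q z).f' x = 0 := by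
    rw [Quartic.f']
    linear_combination e1 + 2 * x * e2 + 3 * x ^ 2 * e3 + 4 * x ^ 3 * e4
      + 2 * (2 * c₂ z * x + c₁ z) * g1
  simp [hfx', hy' z hz] at g2

/-- Two generic points that can be moved separately have Euler integrals that are defined and not
constant. -/
theorem exists_eulerDefined (hB : IsOpen B) (hne : B.Nonempty)
    (hP : ∀ z ∈ B, Generic (D z) z q s P r) (hQ : ∀ z ∈ B, Generic (D' z) z q s Q r')
    (hQ₀ : ∀ z ∈ B, Moves (D z) z q Q 0) {m n : ℕ} (hm : 0 < m) (hn : 0 < n) :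
    ∃ z ∈ B, (q z).EulerDefined (s z) m n (P z) (Q z) ∧
      eulerSpeed (q z) (s z) ((q z).mult (s z) m (P z)) ((q z).mult (s z) n (Q z)) ≠ 0 := by
  have hr : (m : ℂ) * r ≠ 0 := by
    obtain ⟨z, hz⟩ := hne
    exact mul_ne_zero (by exact_mod_cast hm.ne') (hP z hz).speed
  have hr' : (n : ℂ) * r' ≠ 0 := by
    obtain ⟨z, hz⟩ := hne
    exact mul_ne_zero (by exact_mod_cast hn.ne') (hQ z hz).speed
  obtain ⟨B₁, hs₁, ho₁, hn₁, h₁⟩ := exists_multDefined hB hne hP m hm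
  obtain ⟨B₂, hs₂, ho₂, hn₂, h₂⟩ :=
    exists_multDefined ho₁ hn₁ (fun z hz => hQ z (hs₁ hz)) n hn
  have hX : ∀ z ∈ B₂, Moves (D z) z q (fun w => (q w).mult (s w) m (P w)) (m * r) := fun z hz =>
    have hg := hP z (hs₁ (hs₂ hz))
    hg.moves.mult hg.fixed m (h₁ z (hs₂ hz))
  have hY : ∀ z ∈ B₂, Moves (D' z) z q (fun w => (q w).mult (s w) n (Q w)) (n * r') := fun z hz =>
    have hg := hQ z (hs₁ (hs₂ hz))
    hg.moves.mult hg.fixed n (h₂ z hz)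
  have hY₀ : ∀ z ∈ B₂, Moves (D z) z q (fun w => (q w).mult (s w) n (Q w)) 0 := fun z hz => by
    have := (hQ₀ z (hs₁ (hs₂ hz))).mult (hP z (hs₁ (hs₂ hz))).fixed n (h₂ z hz)
    rwa [mul_zero] at this
  have hns : ∀ z ∈ B₂, ∀ x, (q z).f x = 0 → (q z).f' x ≠ 0 := fun z hz =>
    (hP z (hs₁ (hs₂ hz))).nonsingular
  obtain ⟨z₂, hz₂, hy₂⟩ := exists_ordinate_ne_zero ho₂ hn₂ hX hr hns
  obtain ⟨B₃, hs₃, ho₃, hn₃, h₃⟩ := exists_open_subset ho₂ hz₂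
    ((hX z₂ hz₂).snd.continuousAt.eventually_ne hy₂)
  obtain ⟨z₃, hz₃, hy₃⟩ := exists_ordinate_ne_zero ho₃ hn₃ (fun z hz => hY z (hs₃ hz)) hr'
    fun z hz => hns z (hs₃ hz)
  obtain ⟨B₄, hs₄, ho₄, hn₄, h₄⟩ := exists_open_subset ho₃ hz₃
    ((hY z₃ (hs₃ hz₃)).snd.continuousAt.eventually_ne hy₃)
  -- Along `D` the multiple of Q rests, while the abscissa of the multiple of P has nonzero
  -- derivative.
  have hx : ∃ z ∈ B₄, ((q z).mult (s z) m (P z)).1 ≠ ((q z).mult (s z) n (Q z)).1 := by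
    by_contra! h
    obtain ⟨z, hz⟩ := hn₄
    have e := HasD.unique_on ho₄ hz (hX z (hs₃ (hs₄ hz))).fst (hY₀ z (hs₃ (hs₄ hz))).fst h
    rw [zero_mul] at e
    exact mul_ne_zero hr (h₃ z (hs₄ hz)) e
  obtain ⟨z₄, hz₄, hx⟩ := hx
  obtain ⟨B₅, hs₅, ho₅, hn₅, h₅⟩ := exists_open_subset ho₄ hz₄
    (((hX z₄ (hs₃ (hs₄ hz₄))).fst.sub
      (hY₀ z₄ (hs₃ (hs₄ hz₄))).fst).continuousAt.eventually_ne (sub_ne_zero.mpr hx))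
  have hs : B₅ ⊆ B₂ := fun z hz => hs₃ (hs₄ (hs₅ hz))
  obtain ⟨z, hz, h⟩ := exists_eulerSpeed_ne_zero ho₅ hn₅
    (fun z hz => (hP z (hs₁ (hs₂ (hs hz)))).fixed) (fun z hz => hX z (hs hz))
    (fun z hz => hY₀ z (hs hz)) hr (fun z hz => h₃ z (hs₄ (hs₅ hz)))
    (fun z hz => h₄ z (hs₅ hz)) (fun z hz => hns z (hs hz))
    (fun z hz => (hP z (hs₁ (hs₂ (hs hz)))).root) (fun z hz => sub_ne_zero.mp (h₅ z hz))
  exact ⟨z, hs₁ (hs₂ (hs hz)), ⟨h₁ z (hs₂ (hs hz)), h₂ z (hs hz), sub_ne_zero.mp (h₅ z hz)⟩, h⟩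

end Generic

/-! ### The vector fields that move one elliptic coordinate and fix `I₁`, `I₂` -/

section VectorFields

open Topology

/-- The derivation `a ∂/∂pᵢ - b ∂/∂uᵢ`. -/
def direction (i : Fin 2) (a b : ℂ) : (Phase →L[ℝ] ℂ) →ₗ[ℂ] ℂ where
  toFun F := a * F (0, Pi.single i 1) - b * F (Pi.single i 1, 0)
  map_add' F G := by
    simp only [add_apply]
    ring
  map_smul' c F := by
    simp only [smul_apply, smul_eq_mul, RingHom.id_apply]
    ring

variable {i j : Fin 2} {a b : ℂ} {z : Phase}

theorem hasD_comp_u {g : ℝ → ℂ} {g' : ℂ} (h : HasDerivAt g g' (z.1 j)) :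
    HasD (direction i a b) z (fun w => g (w.1 j)) (if j = i then -b * g' else 0) := by
  have hu : HasFDerivAt (fun w : Phase => w.1 j)
      ((ContinuousLinearMap.proj j).comp (ContinuousLinearMap.fst ℝ (Fin 2 → ℝ) (Fin 2 → ℝ))) z :=
    ((ContinuousLinearMap.proj j).comp
      (ContinuousLinearMap.fst ℝ (Fin 2 → ℝ) (Fin 2 → ℝ))).hasFDerivAt
  refine ⟨_, h.hasFDerivAt.comp z hu, ?_⟩
  by_cases e : j = i
  · subst e
    simp [direction]
  · simp [direction, e]

theorem hasD_comp_p {g : ℝ → ℂ} {g' : ℂ} (h : HasDerivAt g g' (z.2 j)) :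
    HasD (direction i a b) z (fun w => g (w.2 j)) (if j = i then a * g' else 0) := by
  have hu : HasFDerivAt (fun w : Phase => w.2 j)
      ((ContinuousLinearMap.proj j).comp (ContinuousLinearMap.snd ℝ (Fin 2 → ℝ) (Fin 2 → ℝ))) z :=
    ((ContinuousLinearMap.proj j).comp
      (ContinuousLinearMap.snd ℝ (Fin 2 → ℝ) (Fin 2 → ℝ))).hasFDerivAt
  refine ⟨_, h.hasFDerivAt.comp z hu, ?_⟩
  by_cases e : j = i
  · subst e
    simp [direction]
  · simp [direction, e]

theorem hasD_u : HasD (direction i a b) z (fun w => (w.1 j : ℂ)) (if j = i then -b else 0) :=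
  (hasD_comp_u (HasDerivAt.ofReal_comp (hasDerivAt_id (z.1 j)))).congr_val (by simp)

theorem hasD_p : HasD (direction i a b) z (fun w => (w.2 j : ℂ)) (if j = i then a else 0) :=
  (hasD_comp_p (HasDerivAt.ofReal_comp (hasDerivAt_id (z.2 j)))).congr_val (by simp)

variable {κ : ℝ} {k : Fin 2 → ℂ} {V : Fin 2 → ℝ → ℂ} {v : ℂ} {F : Phase → ℂ}

/-- The partial derivative of the `i`-th summand with respect to `uᵢ`. -/
def summandU (κ : ℝ) (k : Fin 2 → ℂ) (V : Fin 2 → ℝ → ℂ) (i : Fin 2) (z : Phase) : ℂ :=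
  2 * (z.1 i : ℂ) * (((z.2 i : ℂ) / k i) ^ 2 + V i (z.1 i))
    + ((z.1 i : ℂ) ^ 2 - (κ : ℂ) ^ 2) * deriv (V i) (z.1 i)

/-- The partial derivative of the `i`-th summand with respect to `pᵢ`. -/
def summandP (κ : ℝ) (k : Fin 2 → ℂ) (i : Fin 2) (z : Phase) : ℂ :=
  ((z.1 i : ℂ) ^ 2 - (κ : ℂ) ^ 2) * (2 * ((z.2 i : ℂ) / k i) / k i)

theorem hasD_summand (hV : DifferentiableAt ℝ (V j) (z.1 j)) :
    HasD (direction i a b) z (summand κ k V j)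
      (if j = i then a * summandP κ k i z - b * summandU κ k V i z else 0) := by
  have hp := (hasD_p (i := i) (j := j) (a := a) (b := b) (z := z)).const_mul (k j)⁻¹
  have h := (((hasD_u (i := i) (j := j) (a := a) (b := b) (z := z)).pow 2).sub
    (HasD.const ((κ : ℂ) ^ 2))).mul ((hp.pow 2).add (hasD_comp_u hV.hasDerivAt))
  simp only [inv_mul_eq_div] at h
  refine h.congr_val ?_
  by_cases e : j = i
  · subst e
    simp only [if_true, summandP, summandU]
    push_cast
    ring
  · simp [e]

theorem complex_sq_sub_ne_zero {x y : ℝ} (h : x ^ 2 ≠ y ^ 2) : (x : ℂ) ^ 2 - (y : ℂ) ^ 2 ≠ 0 := by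
  rw [sub_ne_zero]
  exact_mod_cast h

/-- Separation of variables: I₁ and I₂ solve these two linear equations, whose determinant is u₀² -
u₁². It yields both the derivatives of I₂ and the equation of the curve. -/
theorem I₁_mul_sq_add_I₂ (hz : z.1 0 ^ 2 ≠ z.1 1 ^ 2) (i : Fin 2) :
    I₁ κ k V z * (z.1 i : ℂ) ^ 2 + I₂ κ k V z = summand κ k V i z := by
  have h := complex_sq_sub_ne_zero hz
  have h' := complex_sq_sub_ne_zero hz.symm
  have e : (z.1 1 : ℂ) ^ 2 - (z.1 0 : ℂ) ^ 2 = -((z.1 0 : ℂ) ^ 2 - (z.1 1 : ℂ) ^ 2) := by ring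
  rw [I₁, I₂, e]
  fin_cases i
  · simp only [Fin.zero_eta]
    field_simp
    ring
  · simp only [Fin.mk_one]
    field_simp
    ring

/-- The numerator of the derivative of `I₁`. -/
def variation (κ : ℝ) (k : Fin 2 → ℂ) (V : Fin 2 → ℝ → ℂ) (i : Fin 2) (a b : ℂ) (z : Phase) : ℂ :=
  a * summandP κ k i z - b * (summandU κ k V i z - 2 * I₁ κ k V z * (z.1 i : ℂ))

theorem hasD_I₁_zero (hz : z.1 0 ^ 2 ≠ z.1 1 ^ 2) (hV : ∀ i, DifferentiableAt ℝ (V i) (z.1 i)) :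
    HasD (direction 0 a b) z (I₁ κ k V)
      (variation κ k V 0 a b z / ((z.1 0 : ℂ) ^ 2 - (z.1 1 : ℂ) ^ 2)) := by
  have h := complex_sq_sub_ne_zero hz
  have h' := complex_sq_sub_ne_zero hz.symm
  refine (((hasD_summand (hV 0)).div ((hasD_u.pow 2).sub (hasD_u.pow 2)) h).add
    ((hasD_summand (hV 1)).div ((hasD_u.pow 2).sub (hasD_u.pow 2)) h')).congr_val ?_
  have e : (z.1 1 : ℂ) ^ 2 - (z.1 0 : ℂ) ^ 2 = -((z.1 0 : ℂ) ^ 2 - (z.1 1 : ℂ) ^ 2) := by ring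
  simp only [variation, I₁, e, if_true, one_ne_zero, if_false]
  push_cast
  field_simp
  ring

theorem hasD_I₁_one (hz : z.1 0 ^ 2 ≠ z.1 1 ^ 2) (hV : ∀ i, DifferentiableAt ℝ (V i) (z.1 i)) :
    HasD (direction 1 a b) z (I₁ κ k V)
      (-(variation κ k V 1 a b z / ((z.1 0 : ℂ) ^ 2 - (z.1 1 : ℂ) ^ 2))) := by
  have h := complex_sq_sub_ne_zero hz
  have h' := complex_sq_sub_ne_zero hz.symm
  refine (((hasD_summand (hV 0)).div ((hasD_u.pow 2).sub (hasD_u.pow 2)) h).add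
    ((hasD_summand (hV 1)).div ((hasD_u.pow 2).sub (hasD_u.pow 2)) h')).congr_val ?_
  have e : (z.1 1 : ℂ) ^ 2 - (z.1 0 : ℂ) ^ 2 = -((z.1 0 : ℂ) ^ 2 - (z.1 1 : ℂ) ^ 2) := by ring
  simp only [variation, I₁, e, if_true, zero_ne_one, if_false]
  push_cast
  field_simp
  ring

theorem I₂_eventuallyEq (hz : z.1 0 ^ 2 ≠ z.1 1 ^ 2) (i : Fin 2) :
    I₂ κ k V =ᶠ[𝓝 z] fun w => summand κ k V i w - I₁ κ k V w * (w.1 i : ℂ) ^ 2 := by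
  have hc : ContinuousAt (fun w : Phase => w.1 0 ^ 2 - w.1 1 ^ 2) z := by fun_prop
  filter_upwards [hc.eventually_ne (sub_ne_zero.mpr hz)] with w hw
  rw [← I₁_mul_sq_add_I₂ (sub_ne_zero.mp hw) i]
  ring

theorem hasD_I₂_zero (hz : z.1 0 ^ 2 ≠ z.1 1 ^ 2) (hV : ∀ i, DifferentiableAt ℝ (V i) (z.1 i)) :
    HasD (direction 0 a b) z (I₂ κ k V)
      (-((z.1 1 : ℂ) ^ 2 * variation κ k V 0 a b z / ((z.1 0 : ℂ) ^ 2 - (z.1 1 : ℂ) ^ 2))) := by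
  refine (((hasD_summand (hV 0)).sub ((hasD_I₁_zero hz hV).mul (hasD_u.pow 2))).congr_fun
    (I₂_eventuallyEq hz 0)).congr_val ?_
  have h := complex_sq_sub_ne_zero hz
  simp only [variation, if_true]
  push_cast
  field_simp
  ring

theorem hasD_I₂_one (hz : z.1 0 ^ 2 ≠ z.1 1 ^ 2) (hV : ∀ i, DifferentiableAt ℝ (V i) (z.1 i)) :
    HasD (direction 1 a b) z (I₂ κ k V)
      ((z.1 0 : ℂ) ^ 2 * variation κ k V 1 a b z / ((z.1 0 : ℂ) ^ 2 - (z.1 1 : ℂ) ^ 2)) := by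
  refine (((hasD_summand (hV 1)).sub ((hasD_I₁_one hz hV).mul (hasD_u.pow 2))).congr_fun
    (I₂_eventuallyEq hz 1)).congr_val ?_
  have h := complex_sq_sub_ne_zero hz
  simp only [variation, if_true]
  push_cast
  field_simp
  ring

/-- The vector field that moves `uᵢ` and `pᵢ` and fixes `I₁`, `I₂`. -/
def separated (κ : ℝ) (k : Fin 2 → ℂ) (V : Fin 2 → ℝ → ℂ) (i : Fin 2) (z : Phase) :
    (Phase →L[ℝ] ℂ) →ₗ[ℂ] ℂ :=
  direction i (summandU κ k V i z - 2 * I₁ κ k V z * (z.1 i : ℂ)) (summandP κ k i z)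

theorem hasD_separated_I₁ (hz : z.1 0 ^ 2 ≠ z.1 1 ^ 2)
    (hV : ∀ i, DifferentiableAt ℝ (V i) (z.1 i)) :
    HasD (separated κ k V i z) z (I₁ κ k V) 0 := by
  fin_cases i
  · exact (hasD_I₁_zero hz hV).congr_val (by simp [variation]; left; ring)
  · exact (hasD_I₁_one hz hV).congr_val (by simp [variation]; left; ring)

theorem hasD_separated_I₂ (hz : z.1 0 ^ 2 ≠ z.1 1 ^ 2)
    (hV : ∀ i, DifferentiableAt ℝ (V i) (z.1 i)) :
    HasD (separated κ k V i z) z (I₂ κ k V) 0 := by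
  fin_cases i
  · exact (hasD_I₂_zero hz hV).congr_val (by simp [variation]; left; right; ring)
  · exact (hasD_I₂_one hz hV).congr_val (by simp [variation]; left; right; ring)

theorem dU_eq (h : HasD (direction i 0 (-1)) z F a) : dU i F z = a := by
  have := h.eq_fderiv
  simpa [direction, dU] using this

theorem dP_eq (h : HasD (direction i 1 0) z F a) : dP i F z = a := by
  have := h.eq_fderiv
  simpa [direction, dP] using this

/-- The partial derivatives of I₁ in u_i, p_i are, up to the factor ±1/(u₀² - u₁²), the coefficients
of `separated`; the sign is opposite for the two indices. -/
theorem bracket_hamiltonian (hz : z.1 0 ^ 2 ≠ z.1 1 ^ 2)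
    (hV : ∀ i, DifferentiableAt ℝ (V i) (z.1 i)) {d₀ d₁ : ℂ}
    (h₀ : HasD (separated κ k V 0 z) z F d₀) (h₁ : HasD (separated κ k V 1 z) z F d₁) :
    bracket (hamiltonian κ k V) F z
      = 2 * (d₀ - d₁) / ((z.1 0 : ℂ) ^ 2 - (z.1 1 : ℂ) ^ 2) := by
  have h := complex_sq_sub_ne_zero hz
  have e : hamiltonian κ k V = fun w => 2 * I₁ κ k V w := rfl
  rw [e, bracket, Fin.sum_univ_two, dU_eq ((hasD_I₁_zero hz hV).const_mul 2),
    dU_eq ((hasD_I₁_one hz hV).const_mul 2), dP_eq ((hasD_I₁_zero hz hV).const_mul 2),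
    dP_eq ((hasD_I₁_one hz hV).const_mul 2), ← h₀.eq_fderiv, ← h₁.eq_fderiv]
  simp only [separated, direction, LinearMap.coe_mk, AddHom.coe_mk, variation, dU, dP]
  field_simp
  ring

end VectorFields

/-! ### The Kepler and oscillator models -/

namespace Model

open Topology Quartic

variable {M : Model} {κ : ℝ} {α : ℂ} {k : Fin 2 → ℕ} {z : Phase} {s : Phase → ℂ} {i j : Fin 2}

/-- The derivative of the potential. -/
def potentialDeriv (κ : ℝ) (α : ℂ) : Model → ℝ → ℂ
  | kepler, u => (α - 2 * u * (α * u / ((u : ℂ) ^ 2 - (κ : ℂ) ^ 2))) / ((u : ℂ) ^ 2 - (κ : ℂ) ^ 2)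
  | oscillator, u => -2 * α ^ 2 * u

theorem hasDerivAt_potential {u : ℝ} (hu : u ^ 2 ≠ κ ^ 2) :
    HasDerivAt (M.potential κ α) (M.potentialDeriv κ α u) u := by
  have h := complex_sq_sub_ne_zero hu
  have h1 : HasDerivAt (fun x : ℝ => (x : ℂ)) 1 u := HasDerivAt.ofReal_comp (hasDerivAt_id u)
  cases M with
  | kepler =>
    refine ((h1.const_mul α).div ((h1.fun_pow 2).sub_const ((κ : ℂ) ^ 2)) h).congr_deriv ?_
    simp only [potentialDeriv]
    push_cast
    field_simp
  | oscillator =>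
    refine ((h1.fun_pow 2).const_mul (-α ^ 2)).congr_deriv ?_
    simp only [potentialDeriv]
    push_cast
    ring

theorem differentiableAt_potential (hz : z ∈ domain κ) (i : Fin 2) :
    DifferentiableAt ℝ (M.potential κ α) (z.1 i) := by
  fin_cases i
  · exact (hasDerivAt_potential hz.2.1).differentiableAt
  · exact (hasDerivAt_potential hz.2.2).differentiableAt

theorem sq_ne_of_mem_domain (hz : z ∈ domain κ) (i : Fin 2) : z.1 i ^ 2 ≠ κ ^ 2 := by
  fin_cases i
  · exact hz.2.1
  · exact hz.2.2

theorem kC_ne_zero (hk : ∀ i, 0 < k i) (i : Fin 2) : kC k i ≠ 0 := by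
  simpa [kC] using (hk i).ne'

/-- The vector field that moves `Pᵢ` and fixes the curve. -/
def field (M : Model) (κ : ℝ) (α : ℂ) (k : Fin 2 → ℕ) (i : Fin 2) (z : Phase) :
    (Phase →L[ℝ] ℂ) →ₗ[ℂ] ℂ :=
  separated κ (kC k) (fun _ => M.potential κ α) i z

/-- The speed of `kᵢ Pᵢ` along `M.field κ α k i`. -/
def speed : Model → ℂ
  | kepler => -2
  | oscillator => -4

theorem speed_ne_zero : M.speed ≠ 0 := by cases M <;> simp [speed]

/-- The separation relation times u² - κ² (Kepler), or times u²(u² - κ²) (oscillator). -/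
theorem onCurve_point (hk : ∀ i, 0 < k i) (hz : z ∈ domain κ) (i : Fin 2) :
    (M.curve κ α k z).OnCurve (M.point κ (kC k) i z) := by
  have h := complex_sq_sub_ne_zero (sq_ne_of_mem_domain hz i)
  have e := I₁_mul_sq_add_I₂ (κ := κ) (k := kC k) (V := fun _ => M.potential κ α) hz.1 i
  rw [← J₁, ← J₂, summand] at e
  have hki := kC_ne_zero hk i
  have e' : M.J₂ κ α k z = ((z.1 i : ℂ) ^ 2 - (κ : ℂ) ^ 2)
      * (((z.2 i : ℂ) / kC k i) ^ 2 + M.potential κ α (z.1 i))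
      - M.J₁ κ α k z * (z.1 i : ℂ) ^ 2 := by linear_combination e
  cases M with
  | kepler =>
    simp only [OnCurve, Quartic.f, curve, quartic, point]
    rw [e', potential]
    field_simp
    ring
  | oscillator =>
    simp only [OnCurve, Quartic.f, curve, quartic, point]
    rw [e', potential]
    ring

theorem hasD_a₄ {T : (Phase →L[ℝ] ℂ) →ₗ[ℂ] ℂ} (h₁ : HasD T z (M.J₁ κ α k) 0) :
    HasD T z (fun w => (M.curve κ α k w).a₄) 0 := by
  cases M with
  | kepler => exact h₁
  | oscillator => exact HasD.const _

theorem fixed_curve {T : (Phase →L[ℝ] ℂ) →ₗ[ℂ] ℂ} (h₁ : HasD T z (M.J₁ κ α k) 0)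
    (h₂ : HasD T z (M.J₂ κ α k) 0) (hs : HasD T z s 0) (h : s z ^ 2 = (M.curve κ α k z).a₄) :
    Fixed T z (M.curve κ α k) s where
  a₄ := hasD_a₄ h₁
  root := hs
  sq := h
  a₃ := by
    cases M with
    | kepler => exact HasD.const _
    | oscillator => exact (h₁.sub (HasD.const _)).congr_val (sub_zero 0)
  a₂ := by
    cases M with
    | kepler => exact (h₂.sub (h₁.const_mul _)).congr_val (by simp)
    | oscillator =>
      exact (((HasD.const _).sub (h₁.const_mul _)).add h₂).congr_val (by simp)
  a₁ := by
    cases M with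
    | kepler => exact HasD.const _
    | oscillator => exact (h₂.const_mul _).congr_val (mul_zero _)
  a₀ := by
    cases M with
    | kepler => exact (h₂.const_mul _).congr_val (mul_zero _)
    | oscillator => exact HasD.const _

theorem hasD_field_J₁ (hz : z ∈ domain κ) : HasD (M.field κ α k i z) z (M.J₁ κ α k) 0 :=
  hasD_separated_I₁ hz.1 (differentiableAt_potential hz)

theorem hasD_field_J₂ (hz : z ∈ domain κ) : HasD (M.field κ α k i z) z (M.J₂ κ α k) 0 :=
  hasD_separated_I₂ hz.1 (differentiableAt_potential hz)

/-- The momentum enters A_i as p_i/k_i, so its p_i-derivative carries an additional 1/k_i beside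
y_i. This is what multiplication by k_i on the curve compensates. -/
theorem moves_point (hk : ∀ i, 0 < k i) (hz : z ∈ domain κ) (i : Fin 2) :
    Moves (M.field κ α k i z) z (M.curve κ α k) (fun w => M.point κ (kC k) i w)
      (M.speed / kC k i) := by
  have h := complex_sq_sub_ne_zero (sq_ne_of_mem_domain hz i)
  have e := I₁_mul_sq_add_I₂ (κ := κ) (k := kC k) (V := fun _ => M.potential κ α) hz.1 i
  rw [← J₁, ← J₂, summand] at e
  have hki := kC_ne_zero hk i
  have e' : M.J₂ κ α k z = ((z.1 i : ℂ) ^ 2 - (κ : ℂ) ^ 2)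
      * (((z.2 i : ℂ) / kC k i) ^ 2 + M.potential κ α (z.1 i))
      - M.J₁ κ α k z * (z.1 i : ℂ) ^ 2 := by linear_combination e
  have hu : HasD (M.field κ α k i z) z (fun w => (w.1 i : ℂ)) (-summandP κ (kC k) i z) :=
    hasD_u.congr_val (if_pos rfl)
  have hp : HasD (M.field κ α k i z) z (fun w => (w.2 i : ℂ) / kC k i)
      ((summandU κ (kC k) (fun _ => M.potential κ α) i z - 2 * M.J₁ κ α k z * (z.1 i : ℂ))
        / kC k i) :=
    (hasD_p.div (HasD.const (kC k i)) hki).congr_val (by rw [if_pos rfl, J₁]; ring)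
  have hu' := (hu.pow 2).sub (HasD.const ((κ : ℂ) ^ 2))
  refine ⟨?_, ?_, onCurve_point hk hz i⟩
  · cases M with
    | kepler =>
      refine hu.congr_val ?_
      simp only [summandP, speed, point]
      ring
    | oscillator =>
      refine (hu.pow 2).congr_val ?_
      simp only [summandP, speed, point]
      push_cast
      ring
  · cases M with
    | kepler =>
      refine (hu'.mul hp).congr_val ?_
      simp only [summandP, summandU, speed, point, Quartic.f', curve, quartic]
      rw [(hasDerivAt_potential (sq_ne_of_mem_domain hz i)).deriv, e', potential, potentialDeriv]
      field_simp
      push_cast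
      ring
    | oscillator =>
      refine ((hu.mul hu').mul hp).congr_val ?_
      simp only [summandP, summandU, speed, point, Quartic.f', curve, quartic]
      rw [(hasDerivAt_potential (sq_ne_of_mem_domain hz i)).deriv, e', potential, potentialDeriv]
      field_simp
      push_cast
      ring

theorem rests_point (hk : ∀ i, 0 < k i) (hz : z ∈ domain κ) (hij : j ≠ i) :
    Moves (M.field κ α k i z) z (M.curve κ α k) (fun w => M.point κ (kC k) j w) 0 := by
  have hki := kC_ne_zero hk j
  have hu : HasD (M.field κ α k i z) z (fun w => (w.1 j : ℂ)) 0 :=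
    hasD_u.congr_val (if_neg hij)
  have hp : HasD (M.field κ α k i z) z (fun w => (w.2 j : ℂ) / kC k j) 0 :=
    (hasD_p.div (HasD.const (kC k j)) hki).congr_val (by simp [if_neg hij])
  have hu' := (hu.pow 2).sub (HasD.const ((κ : ℂ) ^ 2))
  refine ⟨?_, ?_, onCurve_point hk hz j⟩
  · cases M with
    | kepler => exact hu.congr_val (by simp)
    | oscillator => exact (hu.pow 2).congr_val (by simp)
  · cases M with
    | kepler => exact (hu'.mul hp).congr_val (by simp)
    | oscillator => exact ((hu.mul hu').mul hp).congr_val (by simp)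

variable {U : Set Phase}

/-! ### The function `C` commutes with the Hamiltonian -/

theorem moves_zero (hk : ∀ i, 0 < k i) (hz : z ∈ domain κ) (i : Fin 2) :
    Moves 0 z (M.curve κ α k) (fun w => M.point κ (kC k) i w) 0 where
  fst := (HasD.zero (moves_point (α := α) hk hz i).fst.differentiableAt).congr_val (by simp)
  snd := (HasD.zero (moves_point (α := α) hk hz i).snd.differentiableAt).congr_val (by simp)
  on := onCurve_point hk hz i

theorem hasD_field_root (hU : IsOpen U) (hd : U ⊆ domain κ) (hs : DifferentiableOn ℝ s U)
    (h : ∀ z ∈ U, s z ^ 2 = (M.curve κ α k z).a₄) (hz : z ∈ U) (h0 : s z ≠ 0) :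
    HasD (M.field κ α k i z) z s 0 :=
  (hasD_a₄ (hasD_field_J₁ (hd hz))).of_sq (hs.differentiableAt (hU.mem_nhds hz)) h0
    (Filter.eventually_of_mem (hU.mem_nhds hz) h)

/-- Where the square root cannot be differentiated implicitly the Hamiltonian is critical. -/
theorem hasD_field_root_or_fderiv_J₁ (hU : IsOpen U) (hd : U ⊆ domain κ)
    (hs : DifferentiableOn ℝ s U) (h : ∀ z ∈ U, s z ^ 2 = (M.curve κ α k z).a₄) (hz : z ∈ U) :
    (∀ i, HasD (M.field κ α k i z) z s 0) ∨ fderiv ℝ (M.J₁ κ α k) z = 0 := by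
  by_cases h0 : s z = 0
  · cases M with
    | kepler =>
      right
      have e : kepler.J₁ κ α k =ᶠ[𝓝 z] fun w => s w ^ 2 :=
        Filter.eventually_of_mem (hU.mem_nhds hz) fun w hw => (h w hw).symm
      have hs := (hs.differentiableAt (hU.mem_nhds hz)).hasFDerivAt.pow 2
      rw [e.fderiv_eq, hs.fderiv, h0]
      refine ContinuousLinearMap.ext fun v => ?_
      change (2 • (0 : ℂ) ^ (2 - 1)) * fderiv ℝ s z v = 0
      simp
    | oscillator =>
      left
      intro i
      -- Here a₄ = α² is constant, so one zero of `s` forces α = 0 and `s` vanishes on all of `U`.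
      refine (HasD.const 0).congr_fun (Filter.eventually_of_mem (hU.mem_nhds hz) fun w hw => ?_)
      have hα : α ^ 2 = 0 := by simpa [h0, curve, quartic] using (h z hz).symm
      simpa [curve, quartic, hα] using h w hw
  · exact Or.inl fun i => hasD_field_root hU hd hs h hz h0

/-- The derivative of `C` along `M.field κ α k 0`, up to a constant. -/
def speedC (M : Model) (κ : ℝ) (α : ℂ) (k : Fin 2 → ℕ) (s : Phase → ℂ) (z : Phase) : ℂ :=
  eulerSpeed (M.curve κ α k z) (s z)
    ((M.curve κ α k z).mult (s z) (k 0) (M.point κ (kC k) 0 z))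
    ((M.curve κ α k z).mult (s z) (k 1) (M.point κ (kC k) 1 z))

theorem fixed_field (hz : z ∈ domain κ) (h : s z ^ 2 = (M.curve κ α k z).a₄)
    (hs : HasD (M.field κ α k i z) z s 0) : Fixed (M.field κ α k i z) z (M.curve κ α k) s :=
  fixed_curve (hasD_field_J₁ hz) (hasD_field_J₂ hz) hs h

/-- The value does not depend on `i`: the factor k_i from the multiplication cancels the 1/k_i in
the speed of P_i. -/
theorem hasD_C (hk : ∀ i, 0 < k i) (hz : z ∈ domain κ) (h : s z ^ 2 = (M.curve κ α k z).a₄)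
    (hs : HasD (M.field κ α k i z) z s 0) (hC : M.CDefined κ α k s z) :
    HasD (M.field κ α k i z) z (M.C κ α k s) (M.speed * M.speedC κ α k s z) := by
  have hki := kC_ne_zero hk i
  have hF := fixed_field hz h hs
  fin_cases i
  · refine (hasD_eulerIntegral hF (moves_point hk hz 0) (rests_point hk hz one_ne_zero)
      hC).congr_val ?_
    simp only [kC, Fin.zero_eta, speedC] at hki ⊢
    field_simp
    ring
  · refine (hasD_eulerIntegral hF (rests_point hk hz zero_ne_one) (moves_point hk hz 1)
      hC).congr_val ?_
    simp only [kC, Fin.mk_one, speedC] at hki ⊢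
    field_simp
    ring

theorem differentiableAt_C_and_bracket_eq_zero (hk : ∀ i, 0 < k i) (hU : IsOpen U)
    (hd : U ⊆ domain κ) (hs : DifferentiableOn ℝ s U)
    (h : ∀ z ∈ U, s z ^ 2 = (M.curve κ α k z).a₄) (hz : z ∈ U) (hC : M.CDefined κ α k s z) :
    DifferentiableAt ℝ (M.C κ α k s) z ∧ bracket (M.H κ α k) (M.C κ α k s) z = 0 := by
  rcases hasD_field_root_or_fderiv_J₁ hU hd hs h hz with h0 | h0
  · have hD := fun i => hasD_C hk (hd hz) (h z hz) (h0 i) hC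
    refine ⟨(hD 0).differentiableAt, ?_⟩
    refine (bracket_hamiltonian (hd hz).1 (differentiableAt_potential (hd hz))
      (hD 0) (hD 1)).trans ?_
    simp
  -- At a critical point of H the bracket vanishes trivially; only differentiability of C remains,
  -- obtained from the same formulas with the zero functional.
  · have hJ : DifferentiableAt ℝ (M.J₁ κ α k) z := (hasD_field_J₁ (i := 0) (hd hz)).differentiableAt
    have hF := fixed_curve (HasD.zero hJ)
      (HasD.zero (hasD_field_J₂ (i := 0) (hd hz)).differentiableAt)
      (HasD.zero (hs.differentiableAt (hU.mem_nhds hz))) (h z hz)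
    refine ⟨(hasD_eulerIntegral hF (moves_zero hk (hd hz) 0) (moves_zero hk (hd hz) 1)
      hC).differentiableAt, ?_⟩
    have e : fderiv ℝ (M.H κ α k) z = 0 := by
      have := hJ.hasFDerivAt.const_mul (2 : ℂ)
      rw [h0] at this
      refine this.fderiv.trans (ContinuousLinearMap.ext fun v => ?_)
      exact mul_zero (2 : ℂ)
    simp [bracket, dU, dP, e]

/-! ### Generic phase points -/

/-- A polynomial in `J₁`, `J₂` that vanishes when the curve has a singular point. -/
def singular (κ : ℝ) (α J₁ J₂ : ℂ) : Model → ℂ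
  | kepler => (J₁ * κ ^ 2 - α * κ + J₂) * (J₁ * κ ^ 2 + α * κ + J₂) * (α ^ 2 - 4 * J₁ * J₂)
  | oscillator => J₂ * (J₁ * κ ^ 2 + J₂) * ((J₁ - α ^ 2 * κ ^ 2) ^ 2 - 4 * α ^ 2 * J₂)

/-- The quartic factors as (x² - κ²)(J₁x² - αx + J₂), respectively x(x - κ²)(α²x² + (J₁ - α²κ²)x +
J₂). The factors of `singular` are, up to sign and powers of κ, the values of the last factor at the
two explicit roots, and its discriminant. -/
theorem f'_quartic_ne_zero {J₁ J₂ : ℂ} (hκ : κ ≠ 0) (h : M.singular κ α J₁ J₂ ≠ 0) {x : ℂ}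
    (hx : (M.quartic κ α J₁ J₂).f x = 0) : (M.quartic κ α J₁ J₂).f' x ≠ 0 := by
  intro hx'
  have hκ' : (κ : ℂ) ≠ 0 := by exact_mod_cast hκ
  cases M with
  | kepler =>
    simp only [singular, quartic, Quartic.f, Quartic.f', mul_ne_zero_iff] at *
    obtain ⟨⟨h1, h2⟩, h3⟩ := h
    by_cases e : x ^ 2 - (κ : ℂ) ^ 2 = 0
    · have e' : x * (J₁ * κ ^ 2 - α * x + J₂) = 0 := by
        linear_combination hx' / 2 - (2 * J₁ * x - α / 2) * e
      rcases mul_eq_zero.mp (show (x - κ) * (x + κ) = 0 by linear_combination e) with e | e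
      · obtain rfl : x = κ := sub_eq_zero.mp e
        simp [h1, hκ'] at e'
      · obtain rfl : x = -κ := eq_neg_of_add_eq_zero_left e
        simp [h2, hκ'] at e'
    · have e0 : J₁ * x ^ 2 - α * x + J₂ = 0 := mul_left_cancel₀ e (by linear_combination hx)
      have e1 : 2 * J₁ * x - α = 0 :=
        mul_left_cancel₀ e (by linear_combination hx' - 2 * x * e0)
      exact h3 (by linear_combination (2 * J₁ * x - α) * e1 - 4 * J₁ * e0)
  | oscillator =>
    simp only [singular, quartic, Quartic.f, Quartic.f', mul_ne_zero_iff] at *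
    obtain ⟨⟨h1, h2⟩, h3⟩ := h
    by_cases e : x = 0
    · subst e
      simp [h1, hκ'] at hx'
    · by_cases e' : x - (κ : ℂ) ^ 2 = 0
      · obtain rfl : x = (κ : ℂ) ^ 2 := sub_eq_zero.mp e'
        exact mul_ne_zero (pow_ne_zero 2 hκ') h2 (by linear_combination hx')
      · have e2 := mul_ne_zero e e'
        have e0 : α ^ 2 * x ^ 2 + (J₁ - α ^ 2 * κ ^ 2) * x + J₂ = 0 :=
          mul_left_cancel₀ e2 (by linear_combination hx)
        have e1 : 2 * α ^ 2 * x + (J₁ - α ^ 2 * κ ^ 2) = 0 :=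
          mul_left_cancel₀ e2 (by linear_combination hx' - (2 * x - (κ : ℂ) ^ 2) * e0)
        exact h3 (by
          linear_combination (2 * α ^ 2 * x + (J₁ - α ^ 2 * κ ^ 2)) * e1 - 4 * α ^ 2 * e0)

theorem exists_f_quartic_eq_zero (J₁ J₂ : ℂ) : ∃ x, (M.quartic κ α J₁ J₂).f x = 0 := by
  cases M with
  | kepler =>
    refine ⟨κ, ?_⟩
    simp only [quartic, Quartic.f]
    ring
  | oscillator => exact ⟨0, by simp [quartic, Quartic.f]⟩

/-- Phase points over which the curve is nonsingular and `P₁`, `P₂` are not branch points. -/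
structure IsGeneric (M : Model) (κ : ℝ) (α : ℂ) (k : Fin 2 → ℕ) (z : Phase) : Prop where
  u : ∀ i, z.1 i ≠ 0
  p : ∀ i, z.2 i ≠ 0
  J₁ : M.J₁ κ α k z ≠ 0
  singular : M.singular κ α (M.J₁ κ α k z) (M.J₂ κ α k z) ≠ 0

theorem eventually_isGeneric (hz : z ∈ domain κ) (h : M.IsGeneric κ α k z) :
    ∀ᶠ w in 𝓝 z, M.IsGeneric κ α k w := by
  have h1 : ContinuousAt (M.J₁ κ α k) z := (hasD_field_J₁ (i := 0) hz).continuousAt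
  have h2 : ContinuousAt (M.J₂ κ α k) z := (hasD_field_J₂ (i := 0) hz).continuousAt
  have h3 : ContinuousAt (fun w => M.singular κ α (M.J₁ κ α k w) (M.J₂ κ α k w)) z := by
    cases M <;> simp only [Model.singular] <;> fun_prop
  have hu : ∀ᶠ w : Phase in 𝓝 z, ∀ i, w.1 i ≠ 0 := Filter.eventually_all.mpr fun i =>
    ContinuousAt.eventually_ne (by fun_prop) (h.u i)
  have hp : ∀ᶠ w : Phase in 𝓝 z, ∀ i, w.2 i ≠ 0 := Filter.eventually_all.mpr fun i =>
    ContinuousAt.eventually_ne (by fun_prop) (h.p i)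
  filter_upwards [hu, hp, h1.eventually_ne h.J₁, h3.eventually_ne h.singular] with w a b c d
  exact ⟨a, b, c, d⟩

theorem root_ne_zero_or (h1 : M.J₁ κ α k z ≠ 0) (h : s z ^ 2 = (M.curve κ α k z).a₄) :
    (s z = 0 ∧ M = oscillator ∧ α = 0) ∨ s z ≠ 0 := by
  by_cases h0 : s z = 0
  · left
    cases M with
    | kepler => exact absurd (by simpa [h0, curve, quartic] using h.symm) h1
    | oscillator => exact ⟨h0, rfl, by simpa [h0, curve, quartic] using h.symm⟩
  · exact Or.inr h0

theorem summandP_ne_zero (hk : ∀ i, 0 < k i) (hz : z ∈ domain κ) (hp : z.2 i ≠ 0) :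
    summandP κ (kC k) i z ≠ 0 := by
  have h1 := complex_sq_sub_ne_zero (sq_ne_of_mem_domain hz i)
  have h2 := kC_ne_zero hk i
  have h3 : (z.2 i : ℂ) ≠ 0 := by exact_mod_cast hp
  exact mul_ne_zero h1 (div_ne_zero (mul_ne_zero two_ne_zero (div_ne_zero h3 h2)) h2)

theorem IsGeneric.fderiv_J₁_ne_zero (hg : M.IsGeneric κ α k z) (hk : ∀ i, 0 < k i)
    (hz : z ∈ domain κ) : fderiv ℝ (M.J₁ κ α k) z ≠ 0 := by
  intro h
  have e := (hasD_I₁_zero (a := 1) (b := 0) (κ := κ) (k := kC k) hz.1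
    (differentiableAt_potential (M := M) (α := α) hz)).eq_fderiv
  have h' : fderiv ℝ (I₁ κ (kC k) fun _ => M.potential κ α) z = 0 := h
  rw [h', map_zero, variation, one_mul, zero_mul, sub_zero] at e
  exact div_ne_zero (summandP_ne_zero hk hz (hg.p 0)) (complex_sq_sub_ne_zero hz.1) e.symm

theorem IsGeneric.point (hg : M.IsGeneric κ α k z) (hκ : κ ≠ 0) (hk : ∀ i, 0 < k i)
    (hz : z ∈ domain κ) (h : s z ^ 2 = (M.curve κ α k z).a₄)
    (hs : HasD (M.field κ α k i z) z s 0) :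
    Generic (M.field κ α k i z) z (M.curve κ α k) s (fun w => M.point κ (kC k) i w)
      (M.speed / kC k i) where
  fixed := fixed_field hz h hs
  moves := moves_point hk hz i
  speed := div_ne_zero speed_ne_zero (kC_ne_zero hk i)
  ordinate := by
    have h1 := complex_sq_sub_ne_zero (sq_ne_of_mem_domain hz i)
    have hu : (z.1 i : ℂ) ≠ 0 := by exact_mod_cast hg.u i
    have hp : (z.2 i : ℂ) / kC k i ≠ 0 :=
      div_ne_zero (by exact_mod_cast hg.p i) (kC_ne_zero hk i)
    cases M with
    | kepler => exact mul_ne_zero h1 hp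
    | oscillator => exact mul_ne_zero (mul_ne_zero hu h1) hp
  nonsingular _ := f'_quartic_ne_zero hκ hg.singular
  root := exists_f_quartic_eq_zero _ _
  leading := by
    rcases root_ne_zero_or hg.J₁ h with ⟨-, rfl, rfl⟩ | h0
    · exact Or.inr (by simpa [curve, quartic] using hg.J₁)
    · exact Or.inl h0

/-- Field 0 annihilates dI₁ and dI₂ but not dC, which removes the coefficient of dC. The two
momentum derivatives then give g₀ = g₁u₁² and g₀ = g₁u₀². -/
theorem IsGeneric.linearIndependent (hg : M.IsGeneric κ α k z) (hk : ∀ i, 0 < k i)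
    (hz : z ∈ domain κ) (h : s z ^ 2 = (M.curve κ α k z).a₄)
    (hs : HasD (M.field κ α k 0 z) z s 0) (hC : M.CDefined κ α k s z)
    (h0 : M.speedC κ α k s z ≠ 0) :
    LinearIndependent ℂ ![fderiv ℝ (M.J₁ κ α k) z, fderiv ℝ (M.J₂ κ α k) z,
      fderiv ℝ (M.C κ α k s) z] := by
  have hV := differentiableAt_potential (M := M) (α := α) hz
  rw [Fintype.linearIndependent_iff]
  intro g e
  simp only [Fin.sum_univ_three, Matrix.cons_val_zero, Matrix.cons_val_one,
    Matrix.cons_val_two, Matrix.head_cons, Matrix.tail_cons] at e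
  have e2 := congrArg (M.field κ α k 0 z) e
  simp only [map_add, map_smul, map_zero, smul_eq_mul, (hasD_field_J₁ hz).eq_fderiv,
    (hasD_field_J₂ hz).eq_fderiv, (hasD_C hk hz h hs hC).eq_fderiv, mul_zero, zero_add] at e2
  have g2 : g 2 = 0 := by simpa [speed_ne_zero, h0] using e2
  have hΔ := complex_sq_sub_ne_zero hz.1
  have hP := fun i => summandP_ne_zero (i := i) hk hz (hg.p i)
  have e0 := congrArg (direction 0 1 0) e
  have e1 := congrArg (direction 1 1 0) e
  have a0 : direction 0 1 0 (fderiv ℝ (M.J₁ κ α k) z) = _ :=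
    (hasD_I₁_zero (κ := κ) (k := kC k) hz.1 hV).eq_fderiv
  have a1 : direction 1 1 0 (fderiv ℝ (M.J₁ κ α k) z) = _ :=
    (hasD_I₁_one (κ := κ) (k := kC k) hz.1 hV).eq_fderiv
  have b0 : direction 0 1 0 (fderiv ℝ (M.J₂ κ α k) z) = _ :=
    (hasD_I₂_zero (κ := κ) (k := kC k) hz.1 hV).eq_fderiv
  have b1 : direction 1 1 0 (fderiv ℝ (M.J₂ κ α k) z) = _ :=
    (hasD_I₂_one (κ := κ) (k := kC k) hz.1 hV).eq_fderiv
  simp only [map_add, map_smul, map_zero, smul_eq_mul, a0, a1, b0, b1, variation, one_mul, g2,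
    zero_mul, sub_zero, add_zero] at e0 e1
  field_simp at e0 e1
  have f0 : g 0 - g 1 * (z.1 1 : ℂ) ^ 2 = 0 := mul_left_cancel₀ (hP 0) (by linear_combination e0)
  have f1 : g 0 - g 1 * (z.1 0 : ℂ) ^ 2 = 0 := mul_left_cancel₀ (hP 1) (by linear_combination -e1)
  have g1 : g 1 = 0 := mul_left_cancel₀ hΔ (by linear_combination f0 - f1)
  have g0 : g 0 = 0 := by simpa [g1] using f0
  intro i
  fin_cases i
  · exact g0
  · exact g1
  · exact g2

/-! ### Density of the generic points and conclusion -/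

theorem eventually_eval_ne_zero {p : Polynomial ℂ} (hp : p ≠ 0) (t₀ : ℝ) :
    ∀ᶠ t : ℝ in 𝓝[≠] t₀, p.eval (t : ℂ) ≠ 0 := by
  have hf : {t : ℝ | p.eval (t : ℂ) = 0}.Finite := by
    refine ((p.roots.toFinset.finite_toSet).preimage Complex.ofReal_injective.injOn).subset ?_
    intro t ht
    simpa [hp] using ht
  exact nhdsNE_le_cofinite t₀ hf.compl_mem_cofinite

theorem eventually_quartic_ne_zero {a b c : ℂ} (h : a ≠ 0 ∨ b ≠ 0) (t₀ : ℝ) :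
    ∀ᶠ t : ℝ in 𝓝[≠] t₀, a * (t : ℂ) ^ 4 + b * (t : ℂ) ^ 2 + c ≠ 0 := by
  have hp : Polynomial.C a * Polynomial.X ^ 4 + Polynomial.C b * Polynomial.X ^ 2
      + Polynomial.C c ≠ 0 := by
    intro e
    have e4 := congrArg (fun p => Polynomial.coeff p 4) e
    have e2 := congrArg (fun p => Polynomial.coeff p 2) e
    simp only [Polynomial.coeff_add, Polynomial.coeff_C_mul, Polynomial.coeff_X_pow,
      Polynomial.coeff_C, Polynomial.coeff_zero] at e4 e2
    norm_num at e4 e2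
    tauto
  filter_upwards [eventually_eval_ne_zero hp t₀] with t ht
  simpa using ht

theorem mem_closure_isGeneric (hκ : κ ≠ 0) (hk : ∀ i, 0 < k i) (hU : IsOpen U)
    (hd : U ⊆ domain κ) (hz : z ∈ U) (hu : ∀ i, z.1 i ≠ 0) (hp : z.2 1 ≠ 0) :
    z ∈ closure {w ∈ U | M.IsGeneric κ α k w} := by
  -- Only p₀ = t varies. Then I₁ and I₂ are affine in t² with slopes c and -u₁²c, and each factor of
  -- `singular` is a polynomial in t, nonconstant because c, u₁ and u₁² - κ² are nonzero.
  set w : ℝ → Phase := fun t => (z.1, Function.update z.2 0 t) with hw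
  have hwc : Filter.Tendsto w (𝓝[≠] (z.2 0)) (𝓝 z) := by
    have hc : Continuous w := continuous_const.prodMk (continuous_const.update 0 continuous_id)
    have := hc.tendsto (z.2 0)
    rw [hw] at this
    simp only [Function.update_eq_self] at this
    exact this.mono_left nhdsWithin_le_nhds
  set c : ℂ := ((z.1 0 : ℂ) ^ 2 - (κ : ℂ) ^ 2) / kC k 0 ^ 2
    / ((z.1 0 : ℂ) ^ 2 - (z.1 1 : ℂ) ^ 2) with hc
  have hc0 : c ≠ 0 := div_ne_zero (div_ne_zero (complex_sq_sub_ne_zero (hd hz).2.1)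
    (pow_ne_zero 2 (kC_ne_zero hk 0))) (complex_sq_sub_ne_zero (hd hz).1)
  have h1 : ∀ t, M.J₁ κ α k (w t) = c * (t : ℂ) ^ 2 + M.J₁ κ α k (w 0) := by
    intro t
    simp only [Model.J₁, I₁, summand, hw, hc, Function.update_self, ne_eq, one_ne_zero,
      not_false_eq_true, Function.update_of_ne]
    push_cast
    ring
  have h2 : ∀ t, M.J₂ κ α k (w t) = -(z.1 1 : ℂ) ^ 2 * c * (t : ℂ) ^ 2 + M.J₂ κ α k (w 0) := by
    intro t
    simp only [Model.J₂, I₂, summand, hw, hc, Function.update_self, ne_eq, one_ne_zero,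
      not_false_eq_true, Function.update_of_ne]
    push_cast
    ring
  generalize M.J₁ κ α k (w 0) = c₁ at h1
  generalize M.J₂ κ α k (w 0) = c₂ at h2
  have hκ' : (κ : ℂ) ≠ 0 := by exact_mod_cast hκ
  have hu1 : (z.1 1 : ℂ) ≠ 0 := by exact_mod_cast hu 1
  have hκu : c * ((z.1 1 : ℂ) ^ 2 - (κ : ℂ) ^ 2) ≠ 0 :=
    mul_ne_zero hc0 (complex_sq_sub_ne_zero (hd hz).2.2)
  refine mem_closure_of_tendsto hwc ?_
  have hU' := hwc.eventually (hU.mem_nhds hz)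
  have hJ : ∀ᶠ t in 𝓝[≠] (z.2 0), M.J₁ κ α k (w t) ≠ 0 := by
    filter_upwards [eventually_quartic_ne_zero (a := 0) (c := c₁) (Or.inr hc0) (z.2 0)] with t ht
    rw [h1]
    simpa using ht
  have hS : ∀ᶠ t in 𝓝[≠] (z.2 0), M.singular κ α (M.J₁ κ α k (w t)) (M.J₂ κ α k (w t)) ≠ 0 := by
    have q0 : -c * ((z.1 1 : ℂ) ^ 2 - (κ : ℂ) ^ 2) ≠ 0 := by
      rw [neg_mul]
      exact neg_ne_zero.mpr hκu
    cases M with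
    | kepler =>
      filter_upwards [eventually_quartic_ne_zero (a := 0) (c := c₁ * κ ^ 2 - α * κ + c₂)
          (Or.inr q0) (z.2 0),
        eventually_quartic_ne_zero (a := 0) (c := c₁ * κ ^ 2 + α * κ + c₂) (Or.inr q0) (z.2 0),
        eventually_quartic_ne_zero (a := 4 * c * ((z.1 1 : ℂ) ^ 2 * c))
          (b := -4 * c * c₂ + 4 * c₁ * ((z.1 1 : ℂ) ^ 2 * c)) (c := α ^ 2 - 4 * c₁ * c₂)
          (Or.inl (mul_ne_zero (mul_ne_zero (by norm_num) hc0)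
            (mul_ne_zero (pow_ne_zero 2 hu1) hc0))) (z.2 0)] with t a b d
      rw [singular, h1, h2]
      refine mul_ne_zero (mul_ne_zero ?_ ?_) ?_
      · convert a using 1
        ring
      · convert b using 1
        ring
      · convert d using 1
        ring
    | oscillator =>
      filter_upwards [eventually_quartic_ne_zero (a := 0) (b := -(z.1 1 : ℂ) ^ 2 * c) (c := c₂)
          (Or.inr (mul_ne_zero (neg_ne_zero.mpr (pow_ne_zero 2 hu1)) hc0)) (z.2 0),
        eventually_quartic_ne_zero (a := 0) (c := c₁ * κ ^ 2 + c₂) (Or.inr q0) (z.2 0),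
        eventually_quartic_ne_zero (a := c ^ 2)
          (b := 2 * c * (c₁ - α ^ 2 * κ ^ 2) + 4 * α ^ 2 * ((z.1 1 : ℂ) ^ 2 * c))
          (c := (c₁ - α ^ 2 * κ ^ 2) ^ 2 - 4 * α ^ 2 * c₂)
          (Or.inl (pow_ne_zero 2 hc0)) (z.2 0)] with t a b d
      rw [singular, h1, h2]
      refine mul_ne_zero (mul_ne_zero ?_ ?_) ?_
      · convert a using 1
        ring
      · convert b using 1
        ring
      · convert d using 1
        ring
  have ht0 : ∀ᶠ t : ℝ in 𝓝[≠] (z.2 0), t ≠ 0 :=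
    nhdsNE_le_cofinite _ (Set.finite_singleton (0 : ℝ)).compl_mem_cofinite
  filter_upwards [hU', hJ, hS, ht0] with t a b d e
  refine ⟨a, hu, fun i => ?_, b, d⟩
  fin_cases i
  · simpa [hw] using e
  · simpa [hw] using hp

theorem subset_closure_isGeneric (hκ : κ ≠ 0) (hk : ∀ i, 0 < k i) (hU : IsOpen U)
    (hd : U ⊆ domain κ) : U ⊆ closure {w ∈ U | M.IsGeneric κ α k w} := by
  have key : U ⊆ closure {w ∈ U | (∀ i, w.1 i ≠ 0) ∧ w.2 1 ≠ 0} := by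
    intro z hz
    -- A common shift of all coordinates makes them nonzero for small t ≠ 0, which prepares the
    -- variation of p₀ alone.
    set w : ℝ → Phase := fun t => (fun i => z.1 i + t, fun i => z.2 i + t) with hw
    have hwc : Filter.Tendsto w (𝓝[≠] 0) (𝓝 z) := by
      have hc : Continuous w := by fun_prop
      have := hc.tendsto 0
      rw [hw] at this
      simp only [add_zero] at this
      exact this.mono_left nhdsWithin_le_nhds
    have hne : ∀ x : ℝ, ∀ᶠ t : ℝ in 𝓝[≠] 0, x + t ≠ 0 := fun x => by
      filter_upwards [nhdsNE_le_cofinite (0 : ℝ) (Set.finite_singleton (-x)).compl_mem_cofinite]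
        with t ht h
      exact ht (eq_neg_of_add_eq_zero_right h)
    refine mem_closure_of_tendsto hwc ?_
    filter_upwards [hwc.eventually (hU.mem_nhds hz), Filter.eventually_all.mpr fun i => hne (z.1 i),
      hne (z.2 1)] with t a b d
    exact ⟨a, b, d⟩
  refine key.trans (closure_minimal ?_ isClosed_closure)
  rintro z ⟨hz, hu, hp⟩
  exact mem_closure_isGeneric hκ hk hU hd hz hu hp

theorem exists_dense_independent (hκ : κ ≠ 0) (hk : ∀ i, 0 < k i) (hU : IsOpen U)
    (hd : U ⊆ domain κ) (hs : DifferentiableOn ℝ s U)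
    (h : ∀ z ∈ U, s z ^ 2 = (M.curve κ α k z).a₄) :
    ∃ W : Set Phase, W ⊆ U ∧ IsOpen W ∧ U ⊆ closure W ∧
      ∀ z ∈ W, M.CDefined κ α k s z ∧
        LinearIndependent ℂ ![fderiv ℝ (M.J₁ κ α k) z, fderiv ℝ (M.J₂ κ α k) z,
          fderiv ℝ (M.C κ α k s) z] := by
  -- Nonzero momenta make dI₁ nonzero, so the critical alternative for the square root cannot occur.
  have hroot : ∀ z ∈ U, M.IsGeneric κ α k z → ∀ i, HasD (M.field κ α k i z) z s 0 :=
    fun z hz hg => (hasD_field_root_or_fderiv_J₁ hU hd hs h hz).resolve_right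
      (hg.fderiv_J₁_ne_zero hk (hd hz))
  set V : Set Phase := {w ∈ U | M.IsGeneric κ α k w} with hVdef
  have hVo : IsOpen V := isOpen_iff_mem_nhds.mpr fun z hz =>
    Filter.inter_mem (hU.mem_nhds hz.1) (eventually_isGeneric (hd hz.1) hz.2)
  have hgen : ∀ i, ∀ z ∈ V, Generic (M.field κ α k i z) z (M.curve κ α k) s
      (fun w => M.point κ (kC k) i w) (M.speed / kC k i) := fun i z hz =>
    hz.2.point hκ hk (hd hz.1) (h z hz.1) (hroot z hz.1 hz.2 i)
  have hrest : ∀ z ∈ V, Moves (M.field κ α k 0 z) z (M.curve κ α k)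
      (fun w => M.point κ (kC k) 1 w) 0 := fun z hz => rests_point hk (hd hz.1) one_ne_zero
  refine ⟨{z ∈ V | M.CDefined κ α k s z ∧ M.speedC κ α k s z ≠ 0}, fun z hz => hz.1.1, ?_, ?_, ?_⟩
  · refine isOpen_iff_mem_nhds.mpr fun z hz => ?_
    obtain ⟨hz, hC, h0⟩ := hz
    have hF := (hgen 0 z hz).fixed
    have hP := (hgen 0 z hz).moves
    have hQ := hrest z hz
    have hc : ContinuousAt (M.speedC κ α k s) z := continuousAt_eulerSpeed hF
      (hP.mult hF _ hC.1) (hQ.mult hF _ hC.2.1) hC.2.2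
    exact Filter.inter_mem (hVo.mem_nhds hz)
      ((eventually_eulerDefined hF hP hQ hC).and (hc.eventually_ne h0))
  · refine (subset_closure_isGeneric (M := M) (α := α) hκ hk hU hd).trans
      (closure_minimal ?_ isClosed_closure)
    intro z hz
    by_contra hcl
    -- A generic point outside the closure would have an open generic neighbourhood missing the set,
    -- but every nonempty open set of generic points meets it.
    obtain ⟨w, hw, hC, h0⟩ := exists_eulerDefined (hVo.inter isClosed_closure.isOpen_compl)
      ⟨z, hz, hcl⟩ (fun w hw => hgen 0 w hw.1) (fun w hw => hgen 1 w hw.1)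
      (fun w hw => hrest w hw.1) (hk 0) (hk 1)
    exact hw.2 (subset_closure ⟨hw.1, hC, h0⟩)
  · rintro z ⟨hz, hC, h0⟩
    exact ⟨hC, hz.2.linearIndependent hk (hd hz.1) (h z hz.1) (hroot z hz.1 hz.2 0) hC h0⟩

end Model

end EulerPlane

end

theorem proposition1 :
    -- arbitrary potentials and parameters
    (∀ (κ : ℝ) (_ : 0 < κ) (k : Fin 2 → ℂ) (_ : ∀ i, k i ≠ 0) (V : Fin 2 → ℝ → ℂ)
      (z : EulerPlane.Phase), z.1 0 ^ 2 ≠ z.1 1 ^ 2 →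
      (∀ i, DifferentiableAt ℝ (V i) (z.1 i)) →
        DifferentiableAt ℝ (EulerPlane.hamiltonian κ k V) z ∧
        DifferentiableAt ℝ (EulerPlane.I₂ κ k V) z ∧
        EulerPlane.bracket (EulerPlane.hamiltonian κ k V) (EulerPlane.I₂ κ k V) z = 0) ∧
    -- Kepler and oscillator potentials, positive integers `k₁, k₂`
    (∀ (M : EulerPlane.Model) (κ : ℝ) (_ : 0 < κ) (α : ℂ) (k : Fin 2 → ℕ) (_ : ∀ i, 0 < k i)
      (U : Set EulerPlane.Phase) (_ : IsOpen U) (_ : U ⊆ EulerPlane.domain κ)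
      (s : EulerPlane.Phase → ℂ) (_ : DifferentiableOn ℝ s U)
      (_ : ∀ z ∈ U, s z ^ 2 = (M.curve κ α k z).a₄),
        -- the points `P₁`, `P₂` lie on the curve
        (∀ z ∈ U, ∀ i,
          (M.curve κ α k z).OnCurve (M.point κ (EulerPlane.Model.kC k) i z)) ∧
        -- `C` commutes with `H` wherever it is defined
        (∀ z ∈ U, M.CDefined κ α k s z →
          DifferentiableAt ℝ (M.C κ α k s) z ∧
          EulerPlane.bracket (M.H κ α k) (M.C κ α k s) z = 0) ∧
        -- `C` is defined, and independent of `I₁`, `I₂`, on a dense open set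
        (∃ W : Set EulerPlane.Phase, W ⊆ U ∧ IsOpen W ∧ U ⊆ closure W ∧
          ∀ z ∈ W, M.CDefined κ α k s z ∧
            LinearIndependent ℂ ![fderiv ℝ (M.J₁ κ α k) z, fderiv ℝ (M.J₂ κ α k) z,
              fderiv ℝ (M.C κ α k s) z])) := by

  refine ⟨fun κ _ k _ V z hz hV => ?_, fun M κ hκ α k hk U hU hd s hs h => ⟨fun z hz i => ?_,
    fun z hz hC => ?_, ?_⟩⟩
  · have h₁ := fun i => EulerPlane.hasD_separated_I₁ (κ := κ) (k := k) (i := i) hz hV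
    have h₂ := fun i => EulerPlane.hasD_separated_I₂ (κ := κ) (k := k) (i := i) hz hV
    refine ⟨((h₁ 0).const_mul 2).differentiableAt, (h₂ 0).differentiableAt, ?_⟩
    rw [EulerPlane.bracket_hamiltonian hz hV (h₂ 0) (h₂ 1)]
    simp
  · exact EulerPlane.Model.onCurve_point hk (hd hz) i
  · exact EulerPlane.Model.differentiableAt_C_and_bracket_eq_zero hk hU hd hs h hz hC
  · exact EulerPlane.Model.exists_dense_independent hκ.ne' hk hU hd hs h
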